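/- Let $X$ be a topological space, $\mathbf K\in\{\mathbb R,\mathbb C\}$, $\mathcal A$ a sheaf of unital, commutative, associative $\mathbf K$-algebras over $X$, and $(\mathcal A,d,\Omega^1)$ a differential triad, i.e. $\Omega^1$ is an $\mathcal A$-module and $d:\mathcal A\to\Omega^1$ is a $\mathbf K$-linear morphism with $d(st)=s\,d(t)+t\,d(s)$. Let $n\ge 0$ and let $\mathcal E$ be a vector sheaf of rank $n$, i.e. an $\mathcal A$-module such that $X$ has an open cover by sets $U$ with $\mathcal A^n|_U\cong\mathcal E|_U$ as $\mathcal A|_U$-modules. Let $\mathcal{GL}(n,\mathcal A)$ be the sheaf of groups $U\mapsto GL(n,\mathcal A(U))$, and let $\mathcal P(\mathcal E)$ be the principal sheaf of frames of $\mathcal E$, whose sections over $U$ are the isomorphisms $f:\mathcal A^n|_U\to\mathcal E|_U$ of $\mathcal A|_U$-modules, with structure sheaf $\mathcal{GL}(n,\mathcal A)$ acting on the right by $f\cdot g=f\circ g$. For a principal sheaf $\mathcal P$ with structure sheaf $\mathcal G$ and a representation $\varphi:\mathcal G\to\mathcal{GL}(n,\mathcal A)$ (a morphism of sheaves of groups),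 the sheaf associated with $\mathcal P$ by $\varphi$ is the sheaf generated by $U\mapsto(\mathcal P(U)\times\mathcal A^n(U))/\mathcal G(U)$, where $(s,a)\sim(t,b)$ iff there is a unique $g\in\mathcal G(U)$ with $t=s\cdot g$ and $b=\varphi(g^{-1})\cdot a$; its $\mathcal A$-module structure is the one for which $a\mapsto[s,a]$ is linear for every local section $s$ of $\mathcal P$. An $\mathcal A$-linear connection on $\mathcal E$ is a $\mathbf K$-linear morphism of sheaves $\nabla:\mathcal E\to\mathcal E\otimes_{\mathcal A}\Omega^1$ with $\nabla(a\cdot s)=a\cdot\nabla(s)+s\otimes d(a)$. A connection on $\mathcal P(\mathcal E)$ is a morphism of sheaves of sets $D:\mathcal P(\mathcal E)\to\Omega^1\otimes_{\mathcal A}M_n(\mathcal A)$ with $D(f\cdot g)=\mathcal Ad(g^{-1}).D(f)+\tilde\partial(g)$ for all sections $f$ of $\mathcal P(\mathcal E)$ and $g$ of $\mathcal{GL}(n,\mathcal A)$ over the same open set; here $\mathcal Ad(g).(\theta\otimes a)=\theta\otimes gag^{-1}$ and $\tilde\partial(g)=g^{-1}\cdot(dg_{ij})=\sum_{i,j}dg_{ij}\otimes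 g^{-1}E_{ij}$, with $E_{ij}$ the matrix units. Then: (i) $\mathcal E$ is isomorphic, as an $\mathcal A$-module, to the sheaf associated with $\mathcal P(\mathcal E)$ by the identity representation of $\mathcal{GL}(n,\mathcal A)$, by an isomorphism that sends $[f,a]$ to $f(a)$ for all open $U\subseteq X$, $f\in\mathcal P(\mathcal E)(U)$ and $a\in\mathcal A^n(U)$. (ii) There is a bijection $\nabla\mapsto D$ from the $\mathcal A$-linear connections on $\mathcal E$ onto the connections on $\mathcal P(\mathcal E)$ under which local connection forms agree: for every open $U\subseteq X$ and every frame $f\in\mathcal P(\mathcal E)(U)$, with $e_j\in\mathcal E(U)$ the image under $f$ of the $j$-th standard basis section of $\mathcal A^n(U)$, there is a matrix $(\theta_{ij})$ of sections in $\Omega^1(U)$ with $\nabla(e_j)=\sum_i e_i\otimes\theta_{ij}$ for all $j$ and $D(f)=\sum_{i,j}\theta_{ij}\otimes E_{ij}$. -/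

import Mathlib

open CategoryTheory TopologicalSpace Opposite
universe u
namespace ADG

/-- The sheaf of rings underlying a sheaf of commutative rings. -/
noncomputable abbrev ringSheaf {X : TopCat.{u}} (A : Sheaf (Opens.grothendieckTopology X) CommRingCat.{u}) :
    Sheaf (Opens.grothendieckTopology X) RingCat.{u} :=
  ⟨A.obj ⋙ forget₂ CommRingCat RingCat, by
    exact ((sheafCompose (Opens.grothendieckTopology X) (forget₂ CommRingCat RingCat)).obj A).property⟩

/-- A differential triad `(A, d, Ω)` over `X`: a sheaf `A` of unital commutative associative
`𝕜`-algebras (a sheaf of commutative rings with a morphism from the constant presheaf `𝕜`), an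
`A`-module `Ω` and a `𝕜`-linear derivation `d : A ⟶ Ω` (additive, satisfying the Leibniz rule,
zero on constants). -/
structure DifferentialTriad (𝕜 : Type) [RCLike 𝕜] (X : TopCat.{u}) where
  A : Sheaf (Opens.grothendieckTopology X) CommRingCat.{u}
  scalars : (Functor.const (Opens X)ᵒᵖ).obj (CommRingCat.of (ULift.{u} 𝕜)) ⟶ A.obj
  Ω : SheafOfModules.{u} (ringSheaf A)
  d : Ω.val.Derivation' scalars

/-- The presheaf of `A`-modules `U ↦ M_n(A(U))`. -/
noncomputable def matPresheaf {X : TopCat.{u}} (A : Sheaf (Opens.grothendieckTopology X) CommRingCat.{u}) (n : ℕ) :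
    PresheafOfModules.{u} (A.obj ⋙ forget₂ CommRingCat RingCat) where
  obj U := ModuleCat.of (A.obj.obj U) (Matrix (Fin n) (Fin n) (A.obj.obj U))
  map {U V} f := ModuleCat.ofHom
      (X := Matrix (Fin n) (Fin n) (A.obj.obj U))
      (Y := (ModuleCat.restrictScalars (A.obj.map f).hom).obj (ModuleCat.of _ (Matrix (Fin n) (Fin n) (A.obj.obj V))))
    { toFun := fun a => (a.map (A.obj.map f) : Matrix (Fin n) (Fin n) (A.obj.obj V))
      map_add' := by
        intro a b
        refine Matrix.ext fun i j => ?_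
        exact map_add (A.obj.map f).hom _ _
      map_smul' := by
        intro r a
        refine Matrix.ext fun i j => ?_
        exact map_mul (A.obj.map f).hom _ _ }
  map_id U := by
    ext a
    refine Matrix.ext fun i j => ?_
    exact congrArg (fun k => k.hom (a i j)) (A.obj.map_id U)
  map_comp f g := by
    ext a
    refine Matrix.ext fun i j => ?_
    exact congrArg (fun k => k.hom (a i j)) (A.obj.map_comp f g)

/-- The tensor product `M ⊗ N` of `A`-modules: the sheaf generated by `U ↦ M(U) ⊗ N(U)`. -/
noncomputable def tensorSheaf {X : TopCat.{u}} {A : Sheaf (Opens.grothendieckTopology X) CommRingCat.{u}}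
    (M N : PresheafOfModules.{u} (A.obj ⋙ forget₂ CommRingCat RingCat)) :
    SheafOfModules.{u} (ringSheaf A) :=
  (PresheafOfModules.sheafification (𝟙 (ringSheaf A).obj)).obj
    (PresheafOfModules.Monoidal.tensorObj M N)

open TensorProduct in
/-- The canonical map `M(U) ⊗ N(U) → (M ⊗ N)(U)`. -/
noncomputable def toTensorSheaf {X : TopCat.{u}} {A : Sheaf (Opens.grothendieckTopology X) CommRingCat.{u}}
    (M N : PresheafOfModules.{u} (A.obj ⋙ forget₂ CommRingCat RingCat)) (U : Opens X) :
    M.obj (op U) ⊗[A.obj.obj (op U)] N.obj (op U) →ₗ[A.obj.obj (op U)]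
      (tensorSheaf M N).val.obj (op U) :=
  (((PresheafOfModules.sheafificationAdjunction (𝟙 (ringSheaf A).obj)).unit.app
    (PresheafOfModules.Monoidal.tensorObj M N)).app (op U)).hom


/-- Restriction of sections of a sheaf of commutative rings. -/
noncomputable def ringRes {X : TopCat.{u}}
    (A : Sheaf (Opens.grothendieckTopology X) CommRingCat.{u}) {V U : Opens X} (h : V ≤ U) :
    A.obj.obj (op U) →+* A.obj.obj (op V) :=
  (A.obj.map (homOfLE h).op).hom

/-- Restriction of sections of a presheaf of modules. -/
noncomputable def modRes {X : TopCat.{u}}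
    {A : Sheaf (Opens.grothendieckTopology X) CommRingCat.{u}}
    (M : PresheafOfModules.{u} (A.obj ⋙ forget₂ CommRingCat RingCat)) {V U : Opens X}
    (h : V ≤ U) : M.obj (op U) →+ M.obj (op V) :=
  (M.presheaf.map (homOfLE h).op).hom

theorem modRes_smul {X : TopCat.{u}}
    {A : Sheaf (Opens.grothendieckTopology X) CommRingCat.{u}}
    (M : PresheafOfModules.{u} (A.obj ⋙ forget₂ CommRingCat RingCat)) {V U : Opens X}
    (h : V ≤ U) (a : A.obj.obj (op U)) (m : M.obj (op U)) :
    modRes M h (a • m) = ringRes A h a • modRes M h m :=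
  M.map_smul (homOfLE h).op a m

/-- The elementary sheaf condition for a family of sections with restriction maps. -/
structure IsSh {X : TopCat.{u}} (S : Opens X → Type u)
    (r : ∀ {V U : Opens X}, V ≤ U → S U → S V) : Prop where
  res_self : ∀ {U : Opens X} (s : S U), r le_rfl s = s
  res_res : ∀ {W V U : Opens X} (h : W ≤ V) (k : V ≤ U) (s : S U), r h (r k s) = r (h.trans k) s
  sep : ∀ {U : Opens X} (s t : S U),
    (∀ x ∈ U, ∃ (V : Opens X) (h : V ≤ U), x ∈ V ∧ r h s = r h t) → s = t
  glue : ∀ {U : Opens X} (V : U → Opens X) (hV : ∀ x, V x ≤ U) (_ : ∀ x, x.1 ∈ V x)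
    (s : ∀ x, S (V x)),
    (∀ x y (W : Opens X) (h : W ≤ V x) (k : W ≤ V y), r h (s x) = r k (s y)) →
    ∃ t : S U, ∀ x, r (hV x) t = s x

theorem isSh_of_sheaf {X : TopCat.{u}} (F : Sheaf (Opens.grothendieckTopology X) (Type u)) :
    IsSh (fun U => F.obj.obj (op U)) (fun h => F.obj.map (homOfLE h).op) where
  res_self s := by
    have := ConcreteCategory.congr_hom (F.obj.map_id (op _)) s
    exact this
  res_res h k s := by
    have := ConcreteCategory.congr_hom (F.obj.map_comp (homOfLE k).op (homOfLE h).op) s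
    exact this.symm
  sep {U} s t H := by
    choose V h hx e using H
    exact TopCat.Sheaf.eq_of_locally_eq' F (fun x : U => V x.1 x.2) U (fun x => homOfLE (h x.1 x.2))
      (fun x hxU => Opens.mem_iSup.2 ⟨⟨x, hxU⟩, hx x hxU⟩) s t (fun x => e x.1 x.2)
  glue {U} V hV hx s H := by
    obtain ⟨t, ht, -⟩ := TopCat.Sheaf.existsUnique_gluing' F V U (fun x => homOfLE (hV x))
      (fun x hxU => Opens.mem_iSup.2 ⟨⟨x, hxU⟩, hx _⟩) s
      (fun x y => H x y _ inf_le_left inf_le_right)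
    exact ⟨t, ht⟩

theorem isSheaf_of_isSh {X : TopCat.{u}} (F : TopCat.Presheaf (Type u) X)
    (H : IsSh (fun U => F.obj (op U)) (fun h => F.map (homOfLE h).op)) : F.IsSheaf := by
  apply TopCat.Presheaf.isSheaf_of_isSheafUniqueGluing_types
  intro ι V s hs
  have hmem : ∀ x : (iSup V : Opens X), ∃ i, x.1 ∈ V i := fun x => Opens.mem_iSup.1 x.2
  choose i hi using hmem
  obtain ⟨t, ht⟩ := H.glue (fun x => V (i x)) (fun x => le_iSup V (i x)) hi (fun x => s (i x)) (by
    intro x y W h k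
    have := congrArg (F.map (homOfLE (le_inf h k)).op) (hs (i x) (i y))
    have e1 := H.res_res (le_inf h k) inf_le_left (s (i x))
    have e2 := H.res_res (le_inf h k) inf_le_right (s (i y))
    exact e1.symm.trans (this.trans e2))
  refine ⟨t, ?_, ?_⟩
  · intro j
    refine H.sep (U := V j) _ _ ?_
    intro x hx
    refine ⟨V (i ⟨x, Opens.mem_iSup.2 ⟨j, hx⟩⟩) ⊓ V j, inf_le_right, ⟨hi _, hx⟩, ?_⟩
    have e1 := H.res_res (inf_le_right : V (i ⟨x, Opens.mem_iSup.2 ⟨j, hx⟩⟩) ⊓ V j ≤ V j)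
      (le_iSup V j) t
    have e2 := H.res_res (inf_le_left : V (i ⟨x, Opens.mem_iSup.2 ⟨j, hx⟩⟩) ⊓ V j ≤ _)
      (le_iSup V (i ⟨x, Opens.mem_iSup.2 ⟨j, hx⟩⟩)) t
    have e3 := congrArg (F.map (homOfLE
      (inf_le_left : V (i ⟨x, Opens.mem_iSup.2 ⟨j, hx⟩⟩) ⊓ V j ≤ _)).op)
        (ht ⟨x, Opens.mem_iSup.2 ⟨j, hx⟩⟩)
    exact e1.trans (e2.symm.trans (e3.trans (hs _ _)))
  · intro t' ht'
    refine H.sep _ _ ?_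
    intro x hx
    refine ⟨V (i ⟨x, hx⟩), le_iSup V _, hi _, ?_⟩
    exact (ht' _).trans (ht ⟨x, hx⟩).symm

theorem isSh_ring {X : TopCat.{u}} (A : Sheaf (Opens.grothendieckTopology X) CommRingCat.{u}) :
    IsSh (fun U => A.obj.obj (op U)) (fun h => ringRes A h) :=
  isSh_of_sheaf ⟨A.obj ⋙ forget CommRingCat,
    (TopCat.Presheaf.isSheaf_iff_isSheaf_comp' (forget CommRingCat) A.obj).1 A.property⟩

theorem isSh_module {X : TopCat.{u}} {A : Sheaf (Opens.grothendieckTopology X) CommRingCat.{u}}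
    (E : SheafOfModules.{u} (ringSheaf A)) :
    IsSh (fun U => E.val.obj (op U)) (fun h => modRes E.val h) :=
  isSh_of_sheaf ⟨E.val.presheaf ⋙ forget AddCommGrpCat,
    (TopCat.Presheaf.isSheaf_iff_isSheaf_comp' (forget AddCommGrpCat) E.val.presheaf).1 E.isSheaf⟩

theorem isSh_group {X : TopCat.{u}} (G : Sheaf (Opens.grothendieckTopology X) GrpCat.{u}) :
    IsSh (fun U => G.obj.obj (op U)) (fun h => G.obj.map (homOfLE h).op) :=
  isSh_of_sheaf ⟨G.obj ⋙ forget GrpCat,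
    (TopCat.Presheaf.isSheaf_iff_isSheaf_comp' (forget GrpCat) G.obj).1 G.property⟩

theorem IsSh.pi {X : TopCat.{u}} {S : Opens X → Type u}
    {r : ∀ {V U : Opens X}, V ≤ U → S U → S V} (H : IsSh S r) (ι : Type) :
    IsSh (fun U => ι → S U) (fun h s i => r h (s i)) where
  res_self s := funext fun i => H.res_self _
  res_res h k s := funext fun i => H.res_res h k _
  sep s t h := funext fun i => H.sep _ _ fun x hx => by
    obtain ⟨V, hV, hxV, e⟩ := h x hx
    exact ⟨V, hV, hxV, congrFun e i⟩
  glue V hV hx s h := by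
    have := fun i => H.glue V hV hx (fun x => s x i) (fun x y W h1 h2 => congrFun (h x y W h1 h2) i)
    choose t ht using this
    exact ⟨t, fun x => funext fun i => ht i x⟩

/-- The extension of a local morphism along a locally bijective morphism. -/
theorem IsSh.existsUnique_extend {X : TopCat.{u}} {T S G : Opens X → Type u}
    {rT : ∀ {V U : Opens X}, V ≤ U → T U → T V}
    {rS : ∀ {V U : Opens X}, V ≤ U → S U → S V}
    {rG : ∀ {V U : Opens X}, V ≤ U → G U → G V}
    (HS : IsSh S rS) (HG : IsSh G rG)
    (η : ∀ U, T U → S U)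
    (η_res : ∀ {V U : Opens X} (h : V ≤ U) (t : T U), η V (rT h t) = rS h (η U t))
    (inj : ∀ {U : Opens X} (t t' : T U), η U t = η U t' →
      ∀ x ∈ U, ∃ (V : Opens X) (h : V ≤ U), x ∈ V ∧ rT h t = rT h t')
    (surj : ∀ {U : Opens X} (s : S U),
      ∀ x ∈ U, ∃ (V : Opens X) (h : V ≤ U), x ∈ V ∧ ∃ t, η V t = rS h s)
    {U : Opens X} (m : ∀ V, V ≤ U → T V → G V)
    (m_res : ∀ {W V : Opens X} (h : W ≤ V) (k : V ≤ U) (t : T V),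
      m W (h.trans k) (rT h t) = rG h (m V k t)) (w : S U) :
    ∃! w' : G U, ∀ (V : Opens X) (h : V ≤ U) (t : T V), η V t = rS h w → rG h w' = m V h t := by
  have key : ∀ (V : Opens X) (k : V ≤ U) (t t' : T V), η V t = η V t' → m V k t = m V k t' := by
    intro V k t t' e
    refine HG.sep _ _ fun x hx => ?_
    obtain ⟨W, h, hxW, e'⟩ := inj t t' e x hx
    exact ⟨W, h, hxW, by rw [← m_res h k, ← m_res h k, e']⟩
  have hs := fun x : U => surj w x.1 x.2
  choose V hV hx t ht using hs
  obtain ⟨w', hw'⟩ := HG.glue V hV hx (fun x => m _ (hV x) (t x)) (by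
    intro x y W h k
    rw [← m_res h (hV x), ← m_res k (hV y)]
    apply key
    rw [η_res, η_res, ht, ht, HS.res_res, HS.res_res])
  refine ⟨w', ?_, ?_⟩
  · intro W h s e
    refine HG.sep _ _ fun x hxW => ?_
    have hxU : x ∈ U := h hxW
    refine ⟨V ⟨x, hxU⟩ ⊓ W, inf_le_right, ⟨hx _, hxW⟩, ?_⟩
    rw [HG.res_res, ← HG.res_res inf_le_left (hV ⟨x, hxU⟩), hw', ← m_res inf_le_right h,
      ← m_res inf_le_left (hV ⟨x, hxU⟩)]
    apply key
    rw [η_res, η_res, ht, e, HS.res_res, HS.res_res]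
  · intro w'' hw''
    refine HG.sep _ _ fun x hxU => ?_
    refine ⟨V ⟨x, hxU⟩, hV _, hx _, ?_⟩
    rw [hw', hw'' _ _ _ (ht ⟨x, hxU⟩)]

theorem tensor_res {X : TopCat.{u}} {A : Sheaf (Opens.grothendieckTopology X) CommRingCat.{u}}
    (M N : PresheafOfModules.{u} (A.obj ⋙ forget₂ CommRingCat RingCat)) {V U : Opens X}
    (h : V ≤ U) (t : (PresheafOfModules.Monoidal.tensorObj M N).obj (op U)) :
    toTensorSheaf M N V (modRes (PresheafOfModules.Monoidal.tensorObj M N) h t) =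
      modRes (tensorSheaf M N).val h (toTensorSheaf M N U t) := 
  PresheafOfModules.naturality_apply
    ((PresheafOfModules.sheafificationAdjunction (𝟙 (ringSheaf A).obj)).unit.app
      (PresheafOfModules.Monoidal.tensorObj M N)) (homOfLE h).op t

theorem toTensorSheaf_inj {X : TopCat.{u}} {A : Sheaf (Opens.grothendieckTopology X) CommRingCat.{u}}
    (M N : PresheafOfModules.{u} (A.obj ⋙ forget₂ CommRingCat RingCat)) {U : Opens X}
    (t t' : (PresheafOfModules.Monoidal.tensorObj M N).obj (op U))
    (e : toTensorSheaf M N U t = toTensorSheaf M N U t') (x : X) (hx : x ∈ U) :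
    ∃ (V : Opens X) (h : V ≤ U), x ∈ V ∧
      modRes (PresheafOfModules.Monoidal.tensorObj M N) h t =
        modRes (PresheafOfModules.Monoidal.tensorObj M N) h t' := by
  obtain ⟨V, f, hf, hxV⟩ := CategoryTheory.Presheaf.equalizerSieve_mem
    (Opens.grothendieckTopology X)
    (CategoryTheory.toSheafify (Opens.grothendieckTopology X)
      (PresheafOfModules.Monoidal.tensorObj M N).presheaf) t t' e x hx
  exact ⟨V, f.le, hxV, hf⟩

theorem toTensorSheaf_surj {X : TopCat.{u}} {A : Sheaf (Opens.grothendieckTopology X) CommRingCat.{u}}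
    (M N : PresheafOfModules.{u} (A.obj ⋙ forget₂ CommRingCat RingCat)) {U : Opens X}
    (s : (tensorSheaf M N).val.obj (op U)) (x : X) (hx : x ∈ U) :
    ∃ (V : Opens X) (h : V ≤ U), x ∈ V ∧
      ∃ t : (PresheafOfModules.Monoidal.tensorObj M N).obj (op V), toTensorSheaf M N V t =
        modRes (tensorSheaf M N).val h s := by
  obtain ⟨V, f, hf, hxV⟩ := CategoryTheory.Presheaf.imageSieve_mem
    (Opens.grothendieckTopology X)
    (CategoryTheory.toSheafify (Opens.grothendieckTopology X)
      (PresheafOfModules.Monoidal.tensorObj M N).presheaf) s x hx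
  exact ⟨V, f.le, hxV, hf⟩

/-- The presheaf of groups `U ↦ GL(n, A(U))`. -/
noncomputable def GLPresheaf {X : TopCat.{u}} (A : Sheaf (Opens.grothendieckTopology X) CommRingCat.{u}) (n : ℕ) :
    TopCat.Presheaf GrpCat.{u} X where
  obj U := GrpCat.of (Matrix.GeneralLinearGroup (Fin n) (A.obj.obj U))
  map f := GrpCat.ofHom (Matrix.GeneralLinearGroup.map (A.obj.map f).hom)
  map_id U := by
    refine GrpCat.hom_ext (MonoidHom.ext fun g => Units.ext (Matrix.ext fun i j => ?_))
    exact congrArg (fun k => k.hom (g.1 i j)) (A.obj.map_id U)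
  map_comp f h := by
    refine GrpCat.hom_ext (MonoidHom.ext fun g => Units.ext (Matrix.ext fun i j => ?_))
    exact congrArg (fun k => k.hom (g.1 i j)) (A.obj.map_comp f h)

theorem GLPresheaf_isSheaf {X : TopCat.{u}} (A : Sheaf (Opens.grothendieckTopology X) CommRingCat.{u}) (n : ℕ) :
    (GLPresheaf A n).IsSheaf := by
  refine (TopCat.Presheaf.isSheaf_iff_isSheaf_comp' (forget GrpCat) _).2 (isSheaf_of_isSh _ ?_)
  have H := ((isSh_ring A).pi (Fin n)).pi (Fin n)
  refine ⟨?_, ?_, ?_, ?_⟩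
  · intro U g
    exact ConcreteCategory.congr_hom ((GLPresheaf A n).map_id (op U)) g
  · intro W V U h k g
    exact (ConcreteCategory.congr_hom
      ((GLPresheaf A n).map_comp (homOfLE k).op (homOfLE h).op) g).symm
  · intro U g g' hg
    refine Units.ext (H.sep _ _ fun x hx => ?_)
    obtain ⟨V, h, hxV, e⟩ := hg x hx
    exact ⟨V, h, hxV, congrArg Units.val e⟩
  · intro U V hV hx g hg
    obtain ⟨t, ht⟩ := H.glue V hV hx (fun x => (g x).1)
      (fun x y W h k => congrArg Units.val (hg x y W h k))
    obtain ⟨t', ht'⟩ := H.glue V hV hx (fun x => (g x).2)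
      (fun x y W h k => congrArg Units.inv (hg x y W h k))
    have mul : ∀ {V U : Opens X} (h : V ≤ U) (a b : Matrix (Fin n) (Fin n) (A.obj.obj (op U))),
        (a * b).map (ringRes A h) =
          a.map (ringRes A h) * b.map (ringRes A h) :=
      fun h a b => Matrix.map_mul
    have one : ∀ {V U : Opens X} (h : V ≤ U),
        (1 : Matrix (Fin n) (Fin n) (A.obj.obj (op U))).map (ringRes A h) = 1 :=
      fun h => Matrix.map_one _ (map_zero _) (map_one _)
    refine ⟨(⟨t, t', ?_, ?_⟩ : Matrix.GeneralLinearGroup (Fin n) (A.obj.obj (op U))), ?_⟩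
    · refine H.sep (U := U) _ _ fun x hxU => ⟨V ⟨x, hxU⟩, hV _, hx _, ?_⟩
      refine (mul _ t t').trans (Eq.trans ?_ (one _).symm)
      have e := (g ⟨x, hxU⟩).3
      rw [← ht ⟨x, hxU⟩, ← ht' ⟨x, hxU⟩] at e
      exact e
    · refine H.sep (U := U) _ _ fun x hxU => ⟨V ⟨x, hxU⟩, hV _, hx _, ?_⟩
      refine (mul _ t' t).trans (Eq.trans ?_ (one _).symm)
      have e := (g ⟨x, hxU⟩).4
      rw [← ht ⟨x, hxU⟩, ← ht' ⟨x, hxU⟩] at e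
      exact e
    · intro x
      exact Units.ext (ht x)

/-- The sheaf of groups `GL(n, A)`. -/
noncomputable def GLSheaf {X : TopCat.{u}} (A : Sheaf (Opens.grothendieckTopology X) CommRingCat.{u}) (n : ℕ) :
    Sheaf (Opens.grothendieckTopology X) GrpCat.{u} :=
  ⟨GLPresheaf A n, GLPresheaf_isSheaf A n⟩

open TensorProduct in
/-- `1 ⊗ Ad(g)` on `M(U) ⊗ M_n(A(U))`, where `Ad(g) a = g a g⁻¹`. -/
noncomputable def adTensor {X : TopCat.{u}} {A : Sheaf (Opens.grothendieckTopology X) CommRingCat.{u}} {n : ℕ}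
    (M : PresheafOfModules.{u} (A.obj ⋙ forget₂ CommRingCat RingCat)) {U : Opens X}
    (g : Matrix.GeneralLinearGroup (Fin n) (A.obj.obj (op U))) :
    (M.obj (op U) ⊗[A.obj.obj (op U)] Matrix (Fin n) (Fin n) (A.obj.obj (op U))) →ₗ[A.obj.obj (op U)]
      (M.obj (op U) ⊗[A.obj.obj (op U)] Matrix (Fin n) (Fin n) (A.obj.obj (op U))) :=
  TensorProduct.map LinearMap.id
    (LinearMap.mulRight (A.obj.obj (op U)) (g⁻¹).val ∘ₗ LinearMap.mulLeft (A.obj.obj (op U)) g.val)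

open TensorProduct in
theorem adTensor_res {X : TopCat.{u}} {A : Sheaf (Opens.grothendieckTopology X) CommRingCat.{u}} {n : ℕ}
    (M : PresheafOfModules.{u} (A.obj ⋙ forget₂ CommRingCat RingCat)) {V U : Opens X} (h : V ≤ U)
    (g : Matrix.GeneralLinearGroup (Fin n) (A.obj.obj (op U)))
    (t : (PresheafOfModules.Monoidal.tensorObj M (matPresheaf A n)).obj (op U)) :
    adTensor M (Matrix.GeneralLinearGroup.map (ringRes A h) g)
      (modRes (PresheafOfModules.Monoidal.tensorObj M (matPresheaf A n)) h t) =
    modRes (PresheafOfModules.Monoidal.tensorObj M (matPresheaf A n)) h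
      (adTensor M g t) := by
  have mul : ∀ (a b : Matrix (Fin n) (Fin n) (A.obj.obj (op U))),
      (a * b).map (ringRes A h) =
        a.map (ringRes A h) * b.map (ringRes A h) :=
    fun a b => Matrix.map_mul
  let r : (M.obj (op U) ⊗[A.obj.obj (op U)] Matrix (Fin n) (Fin n) (A.obj.obj (op U))) →+
      (M.obj (op V) ⊗[A.obj.obj (op V)] Matrix (Fin n) (Fin n) (A.obj.obj (op V))) :=
    modRes (PresheafOfModules.Monoidal.tensorObj M (matPresheaf A n)) h
  have hr : ∀ m a, r (m ⊗ₜ a) = modRes M h m ⊗ₜ (a.map (ringRes A h)) :=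
    fun m a => PresheafOfModules.Monoidal.tensorObj_map_tmul (M₁ := M) (M₂ := matPresheaf A n)
      (homOfLE h).op m a
  have main : ∀ t, adTensor M (Matrix.GeneralLinearGroup.map (ringRes A h) g)
      (r t) = r (adTensor M g t) := by
    intro t
    induction t using TensorProduct.induction_on with
    | zero => rw [map_zero, map_zero, map_zero, map_zero]
    | add x y hx hy => rw [map_add, map_add, hx, hy, map_add, map_add]
    | tmul m a =>
      have e1 : adTensor M g (m ⊗ₜ a) = m ⊗ₜ (g.val * a * (g⁻¹).val) := rfl
      rw [e1, hr, hr, mul, mul]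
      rfl
  exact main t

theorem ad_existsUnique {X : TopCat.{u}} {A : Sheaf (Opens.grothendieckTopology X) CommRingCat.{u}} {n : ℕ}
    (M : PresheafOfModules.{u} (A.obj ⋙ forget₂ CommRingCat RingCat)) {U : Opens X}
    (g : Matrix.GeneralLinearGroup (Fin n) (A.obj.obj (op U)))
    (w : (tensorSheaf M (matPresheaf A n)).val.obj (op U)) :
    ∃! w' : (tensorSheaf M (matPresheaf A n)).val.obj (op U),
      ∀ (V : Opens X) (h : V ≤ U)
        (t : (PresheafOfModules.Monoidal.tensorObj M (matPresheaf A n)).obj (op V)),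
        toTensorSheaf M (matPresheaf A n) V t =
            modRes (tensorSheaf M (matPresheaf A n)).val h w →
          modRes (tensorSheaf M (matPresheaf A n)).val h w' =
            toTensorSheaf M (matPresheaf A n) V
              (adTensor M (Matrix.GeneralLinearGroup.map (ringRes A h) g) t) := by
  refine IsSh.existsUnique_extend (isSh_module _) (isSh_module _)
    (T := fun U => (PresheafOfModules.Monoidal.tensorObj M (matPresheaf A n)).obj (op U))
    (rT := fun h => modRes (PresheafOfModules.Monoidal.tensorObj M (matPresheaf A n)) h)
    (fun U => toTensorSheaf M (matPresheaf A n) U) (tensor_res M _)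
    (toTensorSheaf_inj M _) (toTensorSheaf_surj M _)
    (fun V h t => toTensorSheaf M (matPresheaf A n) V
              (adTensor M (Matrix.GeneralLinearGroup.map (ringRes A h) g) t)) 
    ?_ w
  intro W V h k t
  refine Eq.trans ?_ (tensor_res M _ h _)
  refine congrArg (toTensorSheaf M (matPresheaf A n) W) ?_
  refine Eq.trans ?_ (adTensor_res M h _ t)
  refine congrArg (fun g' => adTensor M g' _) ?_
  exact ConcreteCategory.congr_hom
      ((GLPresheaf A n).map_comp (homOfLE k).op (homOfLE h).op) g

/-- The result `Ad(g) . w` of the action of `g ∈ GL(n, A)(U)` on a section `w` of the sheaf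
`M ⊗ M_n(A)` over `U`, i.e. of the endomorphism of `(M ⊗ M_n(A))|_U` generated by
`m ⊗ a ↦ m ⊗ g a g⁻¹`. -/
noncomputable def adAct {X : TopCat.{u}} {A : Sheaf (Opens.grothendieckTopology X) CommRingCat.{u}} {n : ℕ}
    (M : PresheafOfModules.{u} (A.obj ⋙ forget₂ CommRingCat RingCat)) {U : Opens X}
    (g : Matrix.GeneralLinearGroup (Fin n) (A.obj.obj (op U)))
    (w : (tensorSheaf M (matPresheaf A n)).val.obj (op U)) :
    (tensorSheaf M (matPresheaf A n)).val.obj (op U) :=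
  (ad_existsUnique M g w).choose

/-- Frames of `E` over `U`: isomorphisms `Aⁿ|_U ≅ E|_U` of `A|_U`-modules. -/
@[ext]
structure Frame {X : TopCat.{u}} {A : Sheaf (Opens.grothendieckTopology X) CommRingCat.{u}}
    (E : SheafOfModules.{u} (ringSheaf A)) (n : ℕ) (U : Opens X) where
  iso : ∀ V : Opens X, V ≤ U → ((Fin n → A.obj.obj (op V)) ≃ₗ[A.obj.obj (op V)] E.val.obj (op V))
  iso_res : ∀ (W V : Opens X) (h : W ≤ V) (k : V ≤ U) (a : Fin n → A.obj.obj (op V)),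
    iso W (h.trans k) (fun i => ringRes A h (a i)) =
      modRes E.val h (iso V k a)

/-- Multiplication by `g ∈ GL(n, R)` on `Rⁿ`. -/
def GLEquiv {R : Type*} [CommRing R] {n : ℕ} (g : Matrix.GeneralLinearGroup (Fin n) R) :
    (Fin n → R) ≃ₗ[R] (Fin n → R) where
  toFun a := g.val.mulVec a
  map_add' := Matrix.mulVec_add _
  map_smul' r a := Matrix.mulVec_smul _ r a
  invFun a := (g⁻¹).val.mulVec a
  left_inv a := by
    change (g⁻¹).val.mulVec (g.val.mulVec a) = a
    rw [Matrix.mulVec_mulVec, ← Units.val_mul, inv_mul_cancel, Units.val_one, Matrix.one_mulVec]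
  right_inv a := by
    change g.val.mulVec ((g⁻¹).val.mulVec a) = a
    rw [Matrix.mulVec_mulVec, ← Units.val_mul, mul_inv_cancel, Units.val_one, Matrix.one_mulVec]

theorem map_mulVec {R S : Type*} [CommRing R] [CommRing S] (f : R →+* S) {n : ℕ}
    (M : Matrix (Fin n) (Fin n) R) (a : Fin n → R) :
    (M.map f).mulVec (fun i => f (a i)) = fun i => f (M.mulVec a i) := by
  ext i
  simp [Matrix.mulVec, dotProduct]

namespace Frame

variable {X : TopCat.{u}} {A : Sheaf (Opens.grothendieckTopology X) CommRingCat.{u}}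
    {E : SheafOfModules.{u} (ringSheaf A)} {n : ℕ}

/-- Restriction of frames. -/
def res {V U : Opens X} (h : V ≤ U) (f : Frame E n U) : Frame E n V where
  iso W k := f.iso W (k.trans h)
  iso_res W W' k l a := f.iso_res W W' k (l.trans h) a

/-- The action `f · g = f ∘ g` of `GL(n, A)(U)` on frames over `U`. -/
noncomputable def act {U : Opens X} (f : Frame E n U)
    (g : Matrix.GeneralLinearGroup (Fin n) (A.obj.obj (op U))) : Frame E n U where
  iso V h := (GLEquiv (Matrix.GeneralLinearGroup.map (ringRes A h) g)).trans
    (f.iso V h)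
  iso_res W V h k a := by
    refine Eq.trans ?_ (f.iso_res W V h k _)
    refine congrArg (f.iso W (h.trans k)) ?_
    have e : Matrix.GeneralLinearGroup.map (ringRes A (h.trans k)) g =
        Matrix.GeneralLinearGroup.map (ringRes A h)
          (Matrix.GeneralLinearGroup.map (ringRes A k) g) :=
      ConcreteCategory.congr_hom
        ((GLPresheaf A n).map_comp (homOfLE k).op (homOfLE h).op) g
    change (Matrix.GeneralLinearGroup.map (ringRes A (h.trans k)) g).val.mulVec _ = _
    rw [e]
    exact map_mulVec _ _ _

/-- The `j`-th section of the basis of `E` over `U` given by a frame. -/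
def basis {U : Opens X} (f : Frame E n U) (j : Fin n) : E.val.obj (op U) :=
  f.iso U le_rfl (Pi.single j 1)

theorem iso_apply {U : Opens X} (f : Frame E n U) (V : Opens X) (h : V ≤ U)
    (a : Fin n → A.obj.obj (op V)) :
    f.iso V h a = ∑ j, a j • modRes E.val h (f.basis j) := by
  have e : ∀ j, modRes E.val h (f.basis j) = f.iso V h (Pi.single j 1) := by
    intro j
    refine (f.iso_res V U h le_rfl _).symm.trans (congrArg (f.iso V h) (funext fun i => ?_))
    by_cases hij : i = j
    · subst hij
      rw [Pi.single_eq_same, Pi.single_eq_same]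
      exact map_one (ringRes A h)
    · rw [Pi.single_eq_of_ne hij, Pi.single_eq_of_ne hij]
      exact map_zero (ringRes A h)
  conv_lhs => rw [pi_eq_sum_univ' a, map_sum]
  refine Finset.sum_congr rfl fun j _ => ?_
  rw [map_smul, e]

theorem ext_basis {U : Opens X} {f g : Frame E n U} (h : ∀ j, f.basis j = g.basis j) : f = g := by
  ext V k a
  rw [iso_apply, iso_apply]
  simp only [h]

theorem basis_res {V U : Opens X} (h : V ≤ U) (f : Frame E n U) (j : Fin n) :
    (f.res h).basis j = modRes E.val h (f.basis j) := by
  have := (f.res h).iso_apply V le_rfl (Pi.single j 1)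
  have e := f.iso_apply V h (Pi.single j 1)
  refine Eq.trans (b := f.iso V h (Pi.single j 1)) rfl ?_
  rw [e, Finset.sum_eq_single j]
  · rw [Pi.single_eq_same, one_smul]
  · intro i _ hij
    rw [Pi.single_eq_of_ne hij, zero_smul]
  · intro hj
    exact absurd (Finset.mem_univ j) hj

end Frame

theorem res_sum_smul {X : TopCat.{u}} {A : Sheaf (Opens.grothendieckTopology X) CommRingCat.{u}}
    (E : SheafOfModules.{u} (ringSheaf A)) {n : ℕ} {W V U : Opens X} (h : W ≤ V) (k : V ≤ U)
    (e : Fin n → E.val.obj (op U)) (a : Fin n → A.obj.obj (op V)) :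
    modRes E.val h (∑ j, a j • modRes E.val k (e j)) =
      ∑ j, ringRes A h (a j) • modRes E.val (h.trans k) (e j) := by
  refine (map_sum (modRes E.val h) _ _).trans (Finset.sum_congr rfl fun j _ => ?_)
  refine (E.val.map_smul (homOfLE h).op (a j) _).trans ?_
  exact congrArg (fun m : E.val.obj (op W) => ringRes A h (a j) • m)
    ((isSh_module E).res_res h k (e j))

/-- Sections `e₁, …, eₙ` of `E` over `U` that are a basis over each open subset define a frame. -/
noncomputable def Frame.ofSections {X : TopCat.{u}}
    {A : Sheaf (Opens.grothendieckTopology X) CommRingCat.{u}}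
    (E : SheafOfModules.{u} (ringSheaf A)) {n : ℕ} {U : Opens X} (e : Fin n → E.val.obj (op U))
    (he : ∀ (V : Opens X) (h : V ≤ U), Function.Bijective
      (fun a : Fin n → A.obj.obj (op V) => ∑ j, a j • modRes E.val h (e j))) :
    Frame E n U where
  iso V h := LinearEquiv.ofBijective
    { toFun := fun a : Fin n → A.obj.obj (op V) => ∑ j, a j • modRes E.val h (e j)
      map_add' := fun a b => by simp only [Pi.add_apply, add_smul, Finset.sum_add_distrib]
      map_smul' := fun r a => by
        simp only [Pi.smul_apply, smul_eq_mul, mul_smul, Finset.smul_sum, RingHom.id_apply] }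
    (he V h)
  iso_res W V h k a := by exact (res_sum_smul E h k e a).symm

theorem Frame.isSh {X : TopCat.{u}} {A : Sheaf (Opens.grothendieckTopology X) CommRingCat.{u}}
    (E : SheafOfModules.{u} (ringSheaf A)) (n : ℕ) :
    IsSh (fun U => Frame E n U) (fun h f => f.res h) := by
  have HE := isSh_module E
  have HEn := HE.pi (Fin n)
  have HAn := (isSh_ring A).pi (Fin n)
  refine ⟨fun _ => rfl, fun _ _ _ => rfl, ?_, ?_⟩
  · intro U f g H
    refine Frame.ext_basis fun j => HE.sep _ _ fun x hx => ?_
    obtain ⟨V, h, hxV, e⟩ := H x hx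
    refine ⟨V, h, hxV, ?_⟩
    rw [← Frame.basis_res, ← Frame.basis_res, e]
  · intro U V hV hx f H
    obtain ⟨e, he⟩ := HEn.glue V hV hx (fun x j => (f x).basis j) (by
      intro x y W h k
      funext j
      have := congrArg (fun f => f.basis j) (H x y W h k)
      exact ((f x).basis_res h j).symm.trans (this.trans ((f y).basis_res k j)))
    -- over `W ≤ V x` the map given by `e` is the frame `f x`
    have loc : ∀ (x : U) (W : Opens X) (h : W ≤ V x) (a : Fin n → A.obj.obj (op W)),
        ∑ j, a j • modRes E.val (h.trans (hV x)) (e j) = (f x).iso W h a := by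
      intro x W h a
      rw [Frame.iso_apply]
      refine Finset.sum_congr rfl fun j _ => ?_
      refine congrArg (fun m : E.val.obj (op W) => a j • m) ?_
      refine (HE.res_res h (hV x) (e j)).symm.trans ?_
      exact congrArg (modRes E.val h) (congrFun (he x) j)
    refine ⟨Frame.ofSections E e ?_, ?_⟩
    · intro W h
      constructor
      · intro a b hab
        refine HAn.sep _ _ fun x hxW => ?_
        refine ⟨V ⟨x, h hxW⟩ ⊓ W, inf_le_right, ⟨hx _, hxW⟩, ?_⟩
        apply ((f ⟨x, h hxW⟩).iso _ inf_le_left).injective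
        rw [← loc, ← loc]
        have := congrArg (modRes E.val (inf_le_right : V ⟨x, h hxW⟩ ⊓ W ≤ W)) hab
        exact (res_sum_smul E _ h e a).symm.trans (this.trans (res_sum_smul E _ h e b))
      · intro m
        have hW : ∀ x : W, ∃ a : Fin n → A.obj.obj (op (V ⟨x.1, h x.2⟩ ⊓ W)),
            ∑ j, a j • modRes E.val (inf_le_right.trans h) (e j) =
              modRes E.val (inf_le_right : V ⟨x.1, h x.2⟩ ⊓ W ≤ W) m := by
          intro x
          obtain ⟨a, ha⟩ := ((f ⟨x.1, h x.2⟩).iso (V ⟨x.1, h x.2⟩ ⊓ W) inf_le_left).surjective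
            (modRes E.val (inf_le_right : V ⟨x.1, h x.2⟩ ⊓ W ≤ W) m)
          exact ⟨a, (loc _ _ _ a).trans ha⟩
        choose a ha using hW
        obtain ⟨b, hb⟩ := HAn.glue (fun x : W => V ⟨x.1, h x.2⟩ ⊓ W) (fun _ => inf_le_right)
          (fun x => ⟨hx _, x.2⟩) a (by
            intro x y W' h1 h2
            apply ((f ⟨x.1, h x.2⟩).iso W' (h1.trans inf_le_left)).injective
            rw [← loc, ← loc]
            refine (res_sum_smul E h1 (inf_le_right.trans h) e (a x)).symm.trans ?_
            refine Eq.trans ?_ (res_sum_smul E h2 (inf_le_right.trans h) e (a y))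
            rw [ha, ha]
            exact (HE.res_res h1 inf_le_right m).trans (HE.res_res h2 inf_le_right m).symm)
        refine ⟨b, HE.sep _ _ fun x hxW => ⟨V ⟨x, h hxW⟩ ⊓ W, inf_le_right, ⟨hx _, hxW⟩, ?_⟩⟩
        refine (res_sum_smul E _ h e b).trans (Eq.trans ?_ (ha ⟨x, hxW⟩))
        refine Finset.sum_congr rfl fun j _ => ?_
        exact congrArg (fun c : A.obj.obj (op (V ⟨x, h hxW⟩ ⊓ W)) =>
          c • modRes E.val (inf_le_right.trans h) (e j)) (congrFun (hb ⟨x, hxW⟩) j)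
    · intro x
      ext W h a
      exact loc x W h a

/-- The sheaf of sets `U ↦ Iso(Aⁿ|_U, E|_U)`. -/
def frames {X : TopCat.{u}} {A : Sheaf (Opens.grothendieckTopology X) CommRingCat.{u}}
    (E : SheafOfModules.{u} (ringSheaf A)) (n : ℕ) :
    Sheaf (Opens.grothendieckTopology X) (Type u) :=
  ⟨{ obj := fun U => Frame E n U.unop
     map := fun f => TypeCat.ofHom (Frame.res f.unop.le) }, isSheaf_of_isSh _ (Frame.isSh E n)⟩

/-- Restriction of sections of a sheaf of sets. -/
def setRes {X : TopCat.{u}} (P : Sheaf (Opens.grothendieckTopology X) (Type u))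
    {V U : Opens X} (h : V ≤ U) (s : P.obj.obj (op U)) : P.obj.obj (op V) :=
  P.obj.map (homOfLE h).op s

/-- Restriction of sections of a sheaf of groups. -/
def grpRes {X : TopCat.{u}} (G : Sheaf (Opens.grothendieckTopology X) GrpCat.{u})
    {V U : Opens X} (h : V ≤ U) : G.obj.obj (op U) →* G.obj.obj (op V) :=
  (G.obj.map (homOfLE h).op).hom

theorem isSh_set {X : TopCat.{u}} (P : Sheaf (Opens.grothendieckTopology X) (Type u)) :
    IsSh (fun U => P.obj.obj (op U)) (fun h => setRes P h) :=
  isSh_of_sheaf P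

theorem isSh_grp {X : TopCat.{u}} (G : Sheaf (Opens.grothendieckTopology X) GrpCat.{u}) :
    IsSh (fun U => G.obj.obj (op U)) (fun h => grpRes G h) :=
  isSh_group G

/-- Principal sheaves with structure sheaf `G`: sheaves of sets with a right action of `G` that
are locally `G`-equivariantly isomorphic to `G`. -/
structure PrincipalSheaf {X : TopCat.{u}} (G : Sheaf (Opens.grothendieckTopology X) GrpCat.{u})
    where
  sheaf : Sheaf (Opens.grothendieckTopology X) (Type u)
  act : ∀ {U : Opens X}, sheaf.obj.obj (op U) → G.obj.obj (op U) → sheaf.obj.obj (op U)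
  act_one : ∀ {U : Opens X} (s : sheaf.obj.obj (op U)), act s 1 = s
  act_mul : ∀ {U : Opens X} (s : sheaf.obj.obj (op U)) (g h : G.obj.obj (op U)),
    act s (g * h) = act (act s g) h
  act_res : ∀ {V U : Opens X} (h : V ≤ U) (s : sheaf.obj.obj (op U)) (g : G.obj.obj (op U)),
    setRes sheaf h (act s g) = act (setRes sheaf h s) (grpRes G h g)
  locally_trivial : ∀ x : X, ∃ U : Opens X, x ∈ U ∧
    ∃ Φ : ∀ V : Opens X, V ≤ U → (sheaf.obj.obj (op V) ≃ G.obj.obj (op V)),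
      (∀ (W V : Opens X) (h : W ≤ V) (k : V ≤ U) (s : sheaf.obj.obj (op V)),
        Φ W (h.trans k) (setRes sheaf h s) = grpRes G h (Φ V k s)) ∧
      (∀ (V : Opens X) (k : V ≤ U) (s : sheaf.obj.obj (op V)) (g : G.obj.obj (op V)),
        Φ V k (act s g) = Φ V k s * g)

namespace PrincipalSheaf

variable {X : TopCat.{u}} {G : Sheaf (Opens.grothendieckTopology X) GrpCat.{u}}
  (P : PrincipalSheaf G)

theorem act_inj {U : Opens X} (s : P.sheaf.obj.obj (op U)) (g h : G.obj.obj (op U))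
    (e : P.act s g = P.act s h) : g = h := by
  refine (isSh_grp G).sep _ _ fun x hxU => ?_
  obtain ⟨W, hxW, Φ, Φ_res, Φ_act⟩ := P.locally_trivial x
  refine ⟨W ⊓ U, inf_le_right, ⟨hxW, hxU⟩, ?_⟩
  have e' := congrArg (fun t => Φ (W ⊓ U) inf_le_left
    (setRes P.sheaf (inf_le_right : W ⊓ U ≤ U) t)) e
  simp only [P.act_res, Φ_act] at e'
  exact mul_left_cancel e'

theorem exists_act_eq {U : Opens X} (s t : P.sheaf.obj.obj (op U)) : ∃ g, t = P.act s g := by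
  have loc : ∀ x : U, ∃ (V : Opens X) (h : V ≤ U), x.1 ∈ V ∧ ∃ g : G.obj.obj (op V),
      setRes P.sheaf h t = P.act (setRes P.sheaf h s) g := by
    intro x
    obtain ⟨W, hxW, Φ, Φ_res, Φ_act⟩ := P.locally_trivial x.1
    refine ⟨W ⊓ U, inf_le_right, ⟨hxW, x.2⟩,
      (Φ _ inf_le_left (setRes P.sheaf inf_le_right s))⁻¹ *
        Φ _ inf_le_left (setRes P.sheaf inf_le_right t), ?_⟩
    apply (Φ (W ⊓ U) inf_le_left).injective
    rw [Φ_act, mul_inv_cancel_left]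
  choose V hV hx g hg using loc
  obtain ⟨g', hg'⟩ := (isSh_grp G).glue V hV hx g (by
    intro x y W h k
    apply P.act_inj (setRes P.sheaf (h.trans (hV x)) s)
    have e1 := congrArg (setRes P.sheaf h) (hg x)
    have e2 := congrArg (setRes P.sheaf k) (hg y)
    rw [P.act_res, (isSh_set P.sheaf).res_res, (isSh_set P.sheaf).res_res] at e1 e2
    exact e1.symm.trans e2)
  refine ⟨g', (isSh_set P.sheaf).sep _ _ fun x hxU => ⟨V ⟨x, hxU⟩, hV _, hx _, ?_⟩⟩
  rw [P.act_res, hg' ⟨x, hxU⟩, hg]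

end PrincipalSheaf

section Associated

variable {X : TopCat.{u}} {A : Sheaf (Opens.grothendieckTopology X) CommRingCat.{u}}
  {G : Sheaf (Opens.grothendieckTopology X) GrpCat.{u}} {n : ℕ}

/-- A representation `φ : G ⟶ GL(n, A)` on sections. -/
noncomputable def rep (φ : G ⟶ GLSheaf A n) (U : Opens X) :
    G.obj.obj (op U) →* Matrix.GeneralLinearGroup (Fin n) (A.obj.obj (op U)) :=
  (φ.hom.app (op U)).hom

theorem rep_res (φ : G ⟶ GLSheaf A n) {V U : Opens X} (h : V ≤ U) (g : G.obj.obj (op U)) :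
    rep φ V (grpRes G h g) = Matrix.GeneralLinearGroup.map (ringRes A h) (rep φ U g) :=
  ConcreteCategory.congr_hom (φ.hom.naturality (homOfLE h).op) g

variable (P : PrincipalSheaf G) (φ : G ⟶ GLSheaf A n)

/-- The equivalence relation on `P(U) × Aⁿ(U)`: `(s, a) ∼ (t, b)` if there is a unique `g ∈ G(U)`
with `t = s · g` and `b = φ(g⁻¹) · a`. -/
def assocSetoid (U : Opens X) : Setoid (P.sheaf.obj.obj (op U) × (Fin n → A.obj.obj (op U))) where
  r p q := ∃! g : G.obj.obj (op U),
    q.1 = P.act p.1 g ∧ q.2 = (rep φ U g⁻¹).val.mulVec p.2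
  iseqv := by
    have uniq : ∀ (p q : P.sheaf.obj.obj (op U) × (Fin n → A.obj.obj (op U))) (g : G.obj.obj (op U)),
        q.1 = P.act p.1 g ∧ q.2 = (rep φ U g⁻¹).val.mulVec p.2 →
        ∃! g : G.obj.obj (op U), q.1 = P.act p.1 g ∧ q.2 = (rep φ U g⁻¹).val.mulVec p.2 :=
      fun p q g hg => ⟨g, hg, fun g' hg' => P.act_inj p.1 _ _ (hg'.1.symm.trans hg.1)⟩
    refine ⟨fun p => uniq p p 1 ⟨(P.act_one _).symm, ?_⟩, ?_, ?_⟩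
    · rw [inv_one, map_one, Units.val_one, Matrix.one_mulVec]
    · rintro p q ⟨g, ⟨h1, h2⟩, -⟩
      refine uniq q p g⁻¹ ⟨?_, ?_⟩
      · rw [h1, ← P.act_mul, mul_inv_cancel, P.act_one]
      · rw [h2, Matrix.mulVec_mulVec, ← Units.val_mul, ← map_mul, inv_inv, mul_inv_cancel,
          map_one, Units.val_one, Matrix.one_mulVec]
    · rintro p q r ⟨g, ⟨h1, h2⟩, -⟩ ⟨g', ⟨h1', h2'⟩, -⟩
      refine uniq p r (g * g') ⟨?_, ?_⟩
      · rw [h1', h1, ← P.act_mul]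
      · rw [h2', h2, Matrix.mulVec_mulVec, ← Units.val_mul, ← map_mul, mul_inv_rev]

theorem assocSetoid_res {V U : Opens X} (h : V ≤ U)
    (p q : P.sheaf.obj.obj (op U) × (Fin n → A.obj.obj (op U))) (e : (assocSetoid P φ U).r p q) :
    (assocSetoid P φ V).r (setRes P.sheaf h p.1, fun i => ringRes A h (p.2 i))
      (setRes P.sheaf h q.1, fun i => ringRes A h (q.2 i)) := by
  obtain ⟨g, ⟨h1, h2⟩, -⟩ := e
  have e1 : setRes P.sheaf h q.1 = P.act (setRes P.sheaf h p.1) (grpRes G h g) := by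
    rw [h1, P.act_res]
  refine ⟨grpRes G h g, ⟨e1, ?_⟩, fun g' hg' => P.act_inj _ _ _ (hg'.1.symm.trans e1)⟩
  rw [← map_inv, rep_res]
  refine Eq.trans ?_ (map_mulVec (ringRes A h) _ _).symm
  funext i
  exact congrArg (fun v => ringRes A h (v i)) h2

/-- The presheaf `U ↦ Q(U) = (P(U) × Aⁿ(U)) / G(U)`. -/
noncomputable def assocPresheaf : (Opens X)ᵒᵖ ⥤ Type u where
  obj U := Quotient (assocSetoid P φ U.unop)
  map {U V} f := TypeCat.ofHom (Quotient.map
    (fun p => (setRes P.sheaf f.unop.le p.1, fun i => ringRes A f.unop.le (p.2 i)))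
    (assocSetoid_res P φ f.unop.le))
  map_id U := by
    ext p
    induction p using Quotient.inductionOn with
    | h p =>
      exact congrArg (Quotient.mk _) (Prod.ext ((isSh_set P.sheaf).res_self p.1)
        (((isSh_ring A).pi (Fin n)).res_self p.2))
  map_comp {U V W} f g := by
    ext p
    induction p using Quotient.inductionOn with
    | h p =>
      exact congrArg (Quotient.mk _) (Prod.ext
        ((isSh_set P.sheaf).res_res g.unop.le f.unop.le p.1).symm
        (((isSh_ring A).pi (Fin n)).res_res g.unop.le f.unop.le p.2).symm)

/-- The sheaf of sets generated by `U ↦ Q(U)`. -/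
noncomputable def assocSet : Sheaf (Opens.grothendieckTopology X) (Type u) :=
  (presheafToSheaf (Opens.grothendieckTopology X) (Type u)).obj (assocPresheaf P φ)

/-- The section `[s, a]` of the associated sheaf. -/
noncomputable def cls {U : Opens X} (s : P.sheaf.obj.obj (op U)) (a : Fin n → A.obj.obj (op U)) :
    (assocSet P φ).obj.obj (op U) :=
  (toSheafify (Opens.grothendieckTopology X) (assocPresheaf P φ)).app (op U)
    (Quotient.mk (assocSetoid P φ U) (s, a))

theorem cls_res {V U : Opens X} (h : V ≤ U) (s : P.sheaf.obj.obj (op U))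
    (a : Fin n → A.obj.obj (op U)) :
    setRes (assocSet P φ) h (cls P φ s a) =
      cls P φ (setRes P.sheaf h s) (fun i => ringRes A h (a i)) :=
  (ConcreteCategory.congr_hom ((toSheafify (Opens.grothendieckTopology X)
    (assocPresheaf P φ)).naturality (homOfLE h).op)
      (Quotient.mk (assocSetoid P φ U) (s, a))).symm

theorem cls_act {U : Opens X} (s : P.sheaf.obj.obj (op U)) (g : G.obj.obj (op U))
    (a : Fin n → A.obj.obj (op U)) :
    cls P φ (P.act s g) ((rep φ U g⁻¹).val.mulVec a) = cls P φ s a := by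
  refine congrArg ((toSheafify (Opens.grothendieckTopology X) (assocPresheaf P φ)).app (op U))
    (Quotient.sound (s := assocSetoid P φ U) ?_).symm
  exact ⟨g, ⟨rfl, rfl⟩, fun g' hg' => (P.act_inj s _ _ hg'.1).symm⟩

theorem cls_inj {U : Opens X} (s : P.sheaf.obj.obj (op U)) (a b : Fin n → A.obj.obj (op U))
    (e : cls P φ s a = cls P φ s b) : a = b := by
  refine ((isSh_ring A).pi (Fin n)).sep _ _ fun x hx => ?_
  obtain ⟨V, f, hf, hxV⟩ := CategoryTheory.Presheaf.equalizerSieve_mem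
    (Opens.grothendieckTopology X)
    (toSheafify (Opens.grothendieckTopology X) (assocPresheaf P φ)) _ _ e x hx
  refine ⟨V, f.le, hxV, ?_⟩
  obtain ⟨g, ⟨h1, h2⟩, -⟩ := Quotient.exact (s := assocSetoid P φ V) hf
  have hg : g = 1 := P.act_inj _ _ _ (h1.symm.trans (P.act_one _).symm)
  rw [hg, inv_one, map_one, Units.val_one, Matrix.one_mulVec] at h2
  exact h2.symm

theorem cls_locally {U : Opens X} (w : (assocSet P φ).obj.obj (op U)) (x : X) (hx : x ∈ U) :
    ∃ (V : Opens X) (h : V ≤ U), x ∈ V ∧ ∃ (s : P.sheaf.obj.obj (op V))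
      (a : Fin n → A.obj.obj (op V)), cls P φ s a = setRes (assocSet P φ) h w := by
  obtain ⟨V, f, ⟨p, hp⟩, hxV⟩ := CategoryTheory.Presheaf.imageSieve_mem
    (Opens.grothendieckTopology X)
    (toSheafify (Opens.grothendieckTopology X) (assocPresheaf P φ)) w x hx
  induction p using Quotient.inductionOn with
  | h p => exact ⟨V, f.le, hxV, p.1, p.2, hp⟩

theorem cls_eq_of_act (φ : G ⟶ GLSheaf A n) {U : Opens X} (s t : P.sheaf.obj.obj (op U))
    (a : Fin n → A.obj.obj (op U)) : ∃ b, cls P φ s b = cls P φ t a := by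
  obtain ⟨g, hg⟩ := P.exists_act_eq t s
  exact ⟨_, by rw [hg]; exact cls_act P φ t g a⟩

theorem cls_surj {U : Opens X} (s : P.sheaf.obj.obj (op U)) (w : (assocSet P φ).obj.obj (op U)) :
    ∃ a, cls P φ s a = w := by
  have HF := isSh_set (assocSet P φ)
  have loc : ∀ x : U, ∃ (V : Opens X) (h : V ≤ U), x.1 ∈ V ∧ ∃ a : Fin n → A.obj.obj (op V),
      cls P φ (setRes P.sheaf h s) a = setRes (assocSet P φ) h w := by
    intro x
    obtain ⟨V, h, hxV, t, a, e⟩ := cls_locally P φ w x.1 x.2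
    obtain ⟨b, hb⟩ := cls_eq_of_act P φ (setRes P.sheaf h s) t a
    exact ⟨V, h, hxV, b, hb.trans e⟩
  choose V hV hx a ha using loc
  obtain ⟨b, hb⟩ := ((isSh_ring A).pi (Fin n)).glue V hV hx a (by
    intro x y W h k
    apply cls_inj P φ (setRes P.sheaf (h.trans (hV x)) s)
    have e1 := congrArg (setRes (assocSet P φ) h) (ha x)
    have e2 := congrArg (setRes (assocSet P φ) k) (ha y)
    rw [cls_res, HF.res_res, (isSh_set P.sheaf).res_res] at e1 e2
    exact e1.trans e2.symm)
  refine ⟨b, HF.sep _ _ fun x hxU => ⟨V ⟨x, hxU⟩, hV _, hx _, ?_⟩⟩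
  rw [cls_res, ← ha]
  exact congrArg _ (hb ⟨x, hxU⟩)

/-- Tensorial maps `P|_U → Aⁿ|_U`. -/
def tensorial (U : Opens X) : AddSubgroup
    (∀ V : {V : Opens X // V ≤ U}, P.sheaf.obj.obj (op V.1) → Fin n → A.obj.obj (op V.1)) where
  carrier := {f |
    (∀ (W V : Opens X) (h : W ≤ V) (k : V ≤ U) (s : P.sheaf.obj.obj (op V)),
      f ⟨W, h.trans k⟩ (setRes P.sheaf h s) = fun i => ringRes A h (f ⟨V, k⟩ s i)) ∧
    ∀ (V : Opens X) (k : V ≤ U) (s : P.sheaf.obj.obj (op V)) (g : G.obj.obj (op V)),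
      f ⟨V, k⟩ (P.act s g) = (rep φ V g⁻¹).val.mulVec (f ⟨V, k⟩ s)}
  zero_mem' := by
    refine ⟨fun W V h k s => ?_, fun V k s g => ?_⟩
    · funext i
      exact (map_zero (ringRes A h)).symm
    · exact (Matrix.mulVec_zero _).symm
  add_mem' := by
    rintro f f' ⟨h1, h2⟩ ⟨h1', h2'⟩
    refine ⟨fun W V h k s => ?_, fun V k s g => ?_⟩
    · funext i
      simp only [Pi.add_apply, h1 W V h k, h1' W V h k, map_add]
    · simp only [Pi.add_apply, h2, h2', Matrix.mulVec_add]
  neg_mem' := by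
    rintro f ⟨h1, h2⟩
    refine ⟨fun W V h k s => ?_, fun V k s g => ?_⟩
    · funext i
      simp only [Pi.neg_apply, h1 W V h k, map_neg]
    · simp only [Pi.neg_apply, h2, Matrix.mulVec_neg]

/-- Tensorial maps on `P|_U` form an `A(U)`-module under the pointwise operations. -/
noncomputable instance tensorialModule (U : Opens X) :
    Module (A.obj.obj (op U)) (tensorial P φ U) where
  smul r f := ⟨fun V s => ringRes A V.2 r • f.1 V s, by
    obtain ⟨f, h1, h2⟩ := f
    refine ⟨fun W V h k s => ?_, fun V k s g => ?_⟩
    · funext i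
      simp only [Pi.smul_apply, h1 W V h k, smul_eq_mul, map_mul]
      rw [← (isSh_ring A).res_res h k r]
    · simp only [h2, Matrix.mulVec_smul]⟩
  one_smul f := Subtype.ext (by
    funext V s
    exact (congrArg (· • f.1 V s) (map_one (ringRes A V.2))).trans (one_smul _ _))
  mul_smul a b f := Subtype.ext (by
    funext V s
    exact (congrArg (· • f.1 V s) (map_mul (ringRes A V.2) a b)).trans (mul_smul _ _ _))
  smul_zero a := Subtype.ext (by
    funext V s
    exact smul_zero _)
  smul_add a f g := Subtype.ext (by
    funext V s
    exact smul_add _ _ _)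
  add_smul a b f := Subtype.ext (by
    funext V s
    exact (congrArg (· • f.1 V s) (map_add (ringRes A V.2) a b)).trans (add_smul _ _ _))
  zero_smul f := Subtype.ext (by
    funext V s
    exact (congrArg (· • f.1 V s) (map_zero (ringRes A V.2))).trans (zero_smul _ _))

/-- The coordinates of a section `w` of the associated sheaf with respect to `s`, i.e. the
unique `a` such that `w = [s, a]`. -/
noncomputable def coord {U : Opens X} (s : P.sheaf.obj.obj (op U))
    (w : (assocSet P φ).obj.obj (op U)) : Fin n → A.obj.obj (op U) :=
  (cls_surj P φ s w).choose

theorem cls_coord {U : Opens X} (s : P.sheaf.obj.obj (op U))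
    (w : (assocSet P φ).obj.obj (op U)) : cls P φ s (coord P φ s w) = w :=
  (cls_surj P φ s w).choose_spec

theorem coord_cls {U : Opens X} (s : P.sheaf.obj.obj (op U)) (a : Fin n → A.obj.obj (op U)) :
    coord P φ s (cls P φ s a) = a :=
  cls_inj P φ s _ _ (cls_coord P φ s _)

theorem coord_res {V U : Opens X} (h : V ≤ U) (s : P.sheaf.obj.obj (op U))
    (w : (assocSet P φ).obj.obj (op U)) :
    coord P φ (setRes P.sheaf h s) (setRes (assocSet P φ) h w) =
      fun i => ringRes A h (coord P φ s w i) := by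
  apply cls_inj P φ (setRes P.sheaf h s)
  rw [cls_coord, ← cls_res, cls_coord]

theorem coord_act {U : Opens X} (s : P.sheaf.obj.obj (op U)) (g : G.obj.obj (op U))
    (w : (assocSet P φ).obj.obj (op U)) :
    coord P φ (P.act s g) w = (rep φ U g⁻¹).val.mulVec (coord P φ s w) := by
  apply cls_inj P φ (P.act s g)
  rw [cls_act, cls_coord, cls_coord]

/-- Sections of the associated sheaf and their coordinates with respect to all sections of `P`. -/
noncomputable def assocEquiv (U : Opens X) :
    (assocSet P φ).obj.obj (op U) ≃ tensorial P φ U :=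
  Equiv.ofBijective (fun w => ⟨fun V s => coord P φ s (setRes (assocSet P φ) V.2 w), by
    refine ⟨fun W V h k s => ?_, fun V k s g => ?_⟩
    · refine Eq.trans ?_ (coord_res P φ h s _)
      rw [(isSh_set (assocSet P φ)).res_res]
    · exact coord_act P φ s g _⟩) (by
    have HF := isSh_set (assocSet P φ)
    have loc : ∀ x : U, ∃ (V : Opens X) (_ : V ≤ U), x.1 ∈ V ∧ Nonempty (P.sheaf.obj.obj (op V)) := by
      intro x
      obtain ⟨W, hxW, Φ, -, -⟩ := P.locally_trivial x.1
      exact ⟨W ⊓ U, inf_le_right, ⟨hxW, x.2⟩, ⟨(Φ (W ⊓ U) inf_le_left).symm 1⟩⟩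
    choose V hV hx hs using loc
    constructor
    · intro w w' e
      refine HF.sep _ _ fun x hxU => ⟨V ⟨x, hxU⟩, hV _, hx _, ?_⟩
      obtain ⟨s⟩ := hs ⟨x, hxU⟩
      have e' := congrFun (congrFun (congrArg Subtype.val e) ⟨_, hV ⟨x, hxU⟩⟩) s
      rw [← cls_coord P φ s (setRes (assocSet P φ) (hV ⟨x, hxU⟩) w), 
        ← cls_coord P φ s (setRes (assocSet P φ) (hV ⟨x, hxU⟩) w')]
      exact congrArg _ e'
    · rintro ⟨f, h1, h2⟩
      have key : ∀ (W : Opens X) (k : W ≤ U) (s t : P.sheaf.obj.obj (op W)),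
          cls P φ s (f ⟨W, k⟩ s) = cls P φ t (f ⟨W, k⟩ t) := by
        intro W k s t
        obtain ⟨g, rfl⟩ := P.exists_act_eq s t
        rw [h2, cls_act]
      let s : ∀ x : U, P.sheaf.obj.obj (op (V x)) := fun x => (hs x).some
      obtain ⟨w, hw⟩ := HF.glue V hV hx (fun x => cls P φ (s x) (f ⟨_, hV x⟩ (s x))) (by
        intro x y W h k
        rw [cls_res, cls_res, ← h1 W _ h, ← h1 W _ k]
        exact key _ _ _ _)
      refine ⟨w, Subtype.ext ?_⟩
      funext ⟨W, k⟩ t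
      change P.sheaf.obj.obj (op W) at t
      apply cls_inj P φ t
      refine (cls_coord P φ t _).trans ?_
      change setRes (assocSet P φ) k w = cls P φ t (f ⟨W, k⟩ t)
      refine HF.sep _ _ fun x hxW => ⟨V ⟨x, k hxW⟩ ⊓ W, inf_le_right, ⟨hx _, hxW⟩, ?_⟩
      rw [HF.res_res, ← HF.res_res inf_le_left (hV ⟨x, k hxW⟩), hw, cls_res, cls_res,
        ← h1 _ _ inf_le_left, ← h1 _ _ inf_le_right k]
      exact key _ _ _ _)

/-- Sections of the associated sheaf are added in coordinates (see `cls_add`). -/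
noncomputable instance assocAddCommGroup (U : Opens X) :
    AddCommGroup ((assocSet P φ).obj.obj (op U)) :=
  (assocEquiv P φ U).addCommGroup

/-- Sections of the associated sheaf are multiplied by scalars in coordinates (see `cls_smul`). -/
noncomputable instance assocModule (U : Opens X) :
    Module (A.obj.obj (op U)) ((assocSet P φ).obj.obj (op U)) :=
  (assocEquiv P φ U).module (A.obj.obj (op U))

theorem coord_add {U : Opens X} (s : P.sheaf.obj.obj (op U))
    (w w' : (assocSet P φ).obj.obj (op U)) :
    coord P φ s (w + w') = coord P φ s w + coord P φ s w' := by
  have e : assocEquiv P φ U (w + w') = assocEquiv P φ U w + assocEquiv P φ U w' := by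
    rw [Equiv.add_def, Equiv.apply_symm_apply]
  have e' := congrFun (congrFun (congrArg Subtype.val e) ⟨U, le_rfl⟩) s
  have h : ∀ v, setRes (assocSet P φ) (le_refl U) v = v := (isSh_set (assocSet P φ)).res_self
  have e2 : coord P φ s (setRes (assocSet P φ) (le_refl U) (w + w')) =
    coord P φ s (setRes (assocSet P φ) (le_refl U) w) +
      coord P φ s (setRes (assocSet P φ) (le_refl U) w') := e'
  rwa [h, h, h] at e2

theorem coord_smul {U : Opens X} (s : P.sheaf.obj.obj (op U)) (r : A.obj.obj (op U))
    (w : (assocSet P φ).obj.obj (op U)) :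
    coord P φ s (r • w) = r • coord P φ s w := by
  have e : assocEquiv P φ U (r • w) = r • assocEquiv P φ U w := by
    rw [Equiv.smul_def, Equiv.apply_symm_apply]
  have e' := congrFun (congrFun (congrArg Subtype.val e) ⟨U, le_rfl⟩) s
  have h : ∀ v, setRes (assocSet P φ) (le_refl U) v = v := (isSh_set (assocSet P φ)).res_self
  have e2 : coord P φ s (setRes (assocSet P φ) (le_refl U) (r • w)) =
    ringRes A (le_refl U) r • coord P φ s (setRes (assocSet P φ) (le_refl U) w) := e'
  have h' : ringRes A (le_refl U) r = r := (isSh_ring A).res_self r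
  rwa [h, h, h'] at e2

/-- The module structure on the associated sheaf is the one for which each map `a ↦ [s, a]`
is linear. -/
theorem cls_add {U : Opens X} (s : P.sheaf.obj.obj (op U)) (a b : Fin n → A.obj.obj (op U)) :
    cls P φ s (a + b) = cls P φ s a + cls P φ s b := by
  have e := coord_add P φ s (cls P φ s a) (cls P φ s b)
  rw [coord_cls, coord_cls] at e
  rw [← e, cls_coord]

theorem cls_smul {U : Opens X} (s : P.sheaf.obj.obj (op U)) (r : A.obj.obj (op U))
    (a : Fin n → A.obj.obj (op U)) :
    cls P φ s (r • a) = r • cls P φ s a := by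
  have e := coord_smul P φ s r (cls P φ s a)
  rw [coord_cls] at e
  rw [← e, cls_coord]

theorem assocEquiv_res {V U : Opens X} (h : V ≤ U) (w : (assocSet P φ).obj.obj (op U))
    (W : {W : Opens X // W ≤ V}) (s : P.sheaf.obj.obj (op W.1)) :
    (assocEquiv P φ V (setRes (assocSet P φ) h w)).1 W s =
      (assocEquiv P φ U w).1 ⟨W.1, W.2.trans h⟩ s := by
  change coord P φ s (setRes (assocSet P φ) W.2 (setRes (assocSet P φ) h w)) =
    coord P φ s (setRes (assocSet P φ) (W.2.trans h) w)
  rw [(isSh_set (assocSet P φ)).res_res]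

theorem assoc_res_add {V U : Opens X} (h : V ≤ U) (w w' : (assocSet P φ).obj.obj (op U)) :
    setRes (assocSet P φ) h (w + w') = setRes (assocSet P φ) h w + setRes (assocSet P φ) h w' := by
  apply (assocEquiv P φ V).injective
  refine Subtype.ext (funext fun W => funext fun s => ?_)
  refine (assocEquiv_res P φ h _ W s).trans ?_
  rw [Equiv.add_def, Equiv.apply_symm_apply, Equiv.add_def, Equiv.apply_symm_apply]
  exact (congrArg₂ (· + ·) (assocEquiv_res P φ h w W s) (assocEquiv_res P φ h w' W s)).symm

theorem assoc_res_smul {V U : Opens X} (h : V ≤ U) (r : A.obj.obj (op U))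
    (w : (assocSet P φ).obj.obj (op U)) :
    setRes (assocSet P φ) h (r • w) = ringRes A h r • setRes (assocSet P φ) h w := by
  apply (assocEquiv P φ V).injective
  refine Subtype.ext (funext fun W => funext fun s => ?_)
  refine (assocEquiv_res P φ h _ W s).trans ?_
  rw [Equiv.smul_def, Equiv.apply_symm_apply, Equiv.smul_def, Equiv.apply_symm_apply]
  exact (congrArg₂ (· • ·) ((isSh_ring A).res_res W.2 h r) (assocEquiv_res P φ h w W s)).symm

/-- The presheaf of modules of sections of the associated sheaf. -/
noncomputable def assocModulePresheaf :
    PresheafOfModules.{u} (A.obj ⋙ forget₂ CommRingCat RingCat) where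
  obj U := ModuleCat.of (A.obj.obj (op U.unop)) ((assocSet P φ).obj.obj (op U.unop))
  map {U V} f := ModuleCat.ofHom
      (X := (assocSet P φ).obj.obj (op U.unop))
      (Y := (ModuleCat.restrictScalars (A.obj.map f).hom).obj
        (ModuleCat.of (A.obj.obj (op V.unop)) ((assocSet P φ).obj.obj (op V.unop))))
    { toFun := fun w => setRes (assocSet P φ) f.unop.le w
      map_add' := assoc_res_add P φ f.unop.le
      map_smul' := assoc_res_smul P φ f.unop.le }
  map_id U := by
    ext w
    exact (isSh_set (assocSet P φ)).res_self w
  map_comp f g := by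
    ext w
    exact ((isSh_set (assocSet P φ)).res_res g.unop.le f.unop.le w).symm

/-- The sheaf of `A`-modules associated with `P` by the representation `φ`. -/
noncomputable def assoc : SheafOfModules.{u} (ringSheaf A) where
  val := assocModulePresheaf P φ
  isSheaf := (TopCat.Presheaf.isSheaf_iff_isSheaf_comp' (forget AddCommGrpCat) _).2
    (assocSet P φ).property

end Associated

/-- `E` is a vector sheaf of rank `n`: a locally free `A`-module of rank `n`. -/
def IsVectorSheaf {X : TopCat.{u}} {A : Sheaf (Opens.grothendieckTopology X) CommRingCat.{u}}
    (E : SheafOfModules.{u} (ringSheaf A)) (n : ℕ) : Prop :=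
  ∀ x : X, ∃ U : Opens X, x ∈ U ∧ Nonempty (Frame E n U)

namespace Frame

variable {X : TopCat.{u}} {A : Sheaf (Opens.grothendieckTopology X) CommRingCat.{u}}
    {E : SheafOfModules.{u} (ringSheaf A)} {n : ℕ}

theorem act_one {U : Opens X} (f : Frame E n U) : f.act 1 = f := by
  ext V h a
  change f.iso V h ((Matrix.GeneralLinearGroup.map (ringRes A h) 1).val.mulVec a) = f.iso V h a
  rw [map_one, Units.val_one, Matrix.one_mulVec]

theorem act_mul {U : Opens X} (f : Frame E n U)
    (g g' : Matrix.GeneralLinearGroup (Fin n) (A.obj.obj (op U))) :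
    f.act (g * g') = (f.act g).act g' := by
  ext V h a
  change f.iso V h ((Matrix.GeneralLinearGroup.map (ringRes A h) (g * g')).val.mulVec a) =
    f.iso V h ((Matrix.GeneralLinearGroup.map (ringRes A h) g).val.mulVec
      ((Matrix.GeneralLinearGroup.map (ringRes A h) g').val.mulVec a))
  rw [map_mul, Units.val_mul, Matrix.mulVec_mulVec]

theorem res_act {V U : Opens X} (h : V ≤ U) (f : Frame E n U)
    (g : Matrix.GeneralLinearGroup (Fin n) (A.obj.obj (op U))) :
    (f.act g).res h = (f.res h).act (Matrix.GeneralLinearGroup.map (ringRes A h) g) := by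
  ext W k a
  have e : Matrix.GeneralLinearGroup.map (ringRes A (k.trans h)) g =
      Matrix.GeneralLinearGroup.map (ringRes A k)
        (Matrix.GeneralLinearGroup.map (ringRes A h) g) :=
    ConcreteCategory.congr_hom ((GLPresheaf A n).map_comp (homOfLE h).op (homOfLE k).op) g
  change f.iso W (k.trans h)
      ((Matrix.GeneralLinearGroup.map (ringRes A (k.trans h)) g).val.mulVec a) =
    f.iso W (k.trans h) ((Matrix.GeneralLinearGroup.map (ringRes A k)
        (Matrix.GeneralLinearGroup.map (ringRes A h) g)).val.mulVec a)
  rw [e]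

theorem act_basis {U : Opens X} (f : Frame E n U)
    (g : Matrix.GeneralLinearGroup (Fin n) (A.obj.obj (op U))) (j : Fin n) :
    (f.act g).basis j = f.iso U le_rfl (g.val.mulVec (Pi.single j 1)) := by
  have e : Matrix.GeneralLinearGroup.map (ringRes A (le_refl U)) g = g :=
    ConcreteCategory.congr_hom ((GLPresheaf A n).map_id (op U)) g
  change f.iso U le_rfl ((Matrix.GeneralLinearGroup.map (ringRes A (le_refl U)) g).val.mulVec _) = _
  rw [e]

theorem act_bijective {U : Opens X} (f : Frame E n U) : Function.Bijective f.act := by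
  constructor
  · intro g g' e
    refine Units.ext (Matrix.ext fun i j => ?_)
    have e1 := congrArg (fun f' => f'.basis j) e
    simp only [act_basis] at e1
    have e2 := congrFun ((f.iso U le_rfl).injective e1) i
    simpa using e2
  · intro f'
    let L := (f'.iso U le_rfl).trans (f.iso U le_rfl).symm
    let g : Matrix.GeneralLinearGroup (Fin n) (A.obj.obj (op U)) :=
      ⟨LinearMap.toMatrix' L.toLinearMap, LinearMap.toMatrix' L.symm.toLinearMap,
        by rw [← LinearMap.toMatrix'_comp, LinearEquiv.comp_symm, LinearMap.toMatrix'_id],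
        by rw [← LinearMap.toMatrix'_comp, LinearEquiv.symm_comp, LinearMap.toMatrix'_id]⟩
    refine ⟨g, ext_basis fun j => ?_⟩
    rw [act_basis]
    have e : g.val.mulVec (Pi.single j 1) = L (Pi.single j 1) :=
      LinearMap.toMatrix'_mulVec L.toLinearMap _
    rw [e]
    exact (f.iso U le_rfl).apply_symm_apply _

end Frame

/-- The sheaf of frames `P(E)` of a vector sheaf `E`, a principal sheaf with structure sheaf
`GL(n, A)` acting by `f · g = f ∘ g`. -/
noncomputable def frameSheaf {X : TopCat.{u}}
    {A : Sheaf (Opens.grothendieckTopology X) CommRingCat.{u}}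
    (E : SheafOfModules.{u} (ringSheaf A)) (n : ℕ) (hE : IsVectorSheaf E n) :
    PrincipalSheaf (GLSheaf A n) where
  sheaf := frames E n
  act := fun f g => Frame.act f g
  act_one := fun f => Frame.act_one f
  act_mul := fun f g g' => Frame.act_mul f g g'
  act_res := fun h f g => Frame.res_act h f g
  locally_trivial x := by
    obtain ⟨U, hxU, ⟨ψ⟩⟩ := hE x
    let e : ∀ V : Opens X, V ≤ U →
        (Matrix.GeneralLinearGroup (Fin n) (A.obj.obj (op V)) ≃ Frame E n V) :=
      fun V h => Equiv.ofBijective (ψ.res h).act (ψ.res h).act_bijective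
    refine ⟨U, hxU, fun V h => (e V h).symm, ?_, ?_⟩
    · intro W V h k (f : Frame E n V)
      apply (e W (h.trans k)).injective
      refine ((e W (h.trans k)).apply_symm_apply _).trans ?_
      refine Eq.trans ?_ (Frame.res_act h (ψ.res k) _)
      exact congrArg (Frame.res h) ((e V k).apply_symm_apply f).symm
    · intro V k (f : Frame E n V) g
      apply (e V k).injective
      refine ((e V k).apply_symm_apply _).trans ?_
      refine Eq.trans ?_ (Frame.act_mul (ψ.res k) _ g).symm
      exact congrArg (fun f' => Frame.act f' g) ((e V k).apply_symm_apply f).symm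

section Connections

variable {𝕜 : Type} [RCLike 𝕜] {X : TopCat.{u}}

/-- The constant sections of the structure sheaf. -/
noncomputable def DifferentialTriad.const (T : DifferentialTriad 𝕜 X) (U : Opens X) (c : 𝕜) :
    T.A.obj.obj (op U) :=
  (T.scalars.app (op U)).hom (ULift.up c)

/-- The derivation `d` on sections. -/
noncomputable def DifferentialTriad.diff (T : DifferentialTriad 𝕜 X) {U : Opens X}
    (a : T.A.obj.obj (op U)) : T.Ω.val.obj (op U) :=
  T.d.d (X := op U) a

open TensorProduct in
/-- The section `s ⊗ t` of `M ⊗ N`. -/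
noncomputable def tensorSec {A : Sheaf (Opens.grothendieckTopology X) CommRingCat.{u}}
    (M N : PresheafOfModules.{u} (A.obj ⋙ forget₂ CommRingCat RingCat)) {U : Opens X}
    (s : M.obj (op U)) (t : N.obj (op U)) : (tensorSheaf M N).val.obj (op U) :=
  toTensorSheaf M N U (s ⊗ₜ[A.obj.obj (op U)] t)

/-- `A`-connections on an `A`-module `E`: `𝕜`-linear morphisms `∇ : E ⟶ E ⊗ Ω` satisfying the
Leibniz-Koszul condition. -/
structure ModuleConnection (T : DifferentialTriad 𝕜 X) (E : SheafOfModules.{u} (ringSheaf T.A))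
    where
  toFun : ∀ U : Opens X, E.val.obj (op U) → (tensorSheaf E.val T.Ω.val).val.obj (op U)
  map_res : ∀ {V U : Opens X} (h : V ≤ U) (s : E.val.obj (op U)),
    toFun V (modRes E.val h s) = modRes (tensorSheaf E.val T.Ω.val).val h (toFun U s)
  map_add : ∀ (U : Opens X) (s t : E.val.obj (op U)), toFun U (s + t) = toFun U s + toFun U t
  map_scalar : ∀ (U : Opens X) (c : 𝕜) (s : E.val.obj (op U)),
    toFun U (T.const U c • s) = T.const U c • toFun U s
  leibniz : ∀ (U : Opens X) (a : T.A.obj.obj (op U)) (s : E.val.obj (op U)),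
    toFun U (a • s) = a • toFun U s + tensorSec E.val T.Ω.val s (T.diff a)

/-- The sheaf `Ω ⊗ M_n(A)`. -/
noncomputable abbrev DifferentialTriad.matrixForms (T : DifferentialTriad 𝕜 X) (n : ℕ) :
    SheafOfModules.{u} (ringSheaf T.A) :=
  tensorSheaf T.Ω.val (matPresheaf T.A n)

/-- The section `∑ θᵢⱼ ⊗ Eᵢⱼ` of `Ω ⊗ M_n(A)` given by a matrix of sections of `Ω`. -/
noncomputable def DifferentialTriad.ofMatrix (T : DifferentialTriad 𝕜 X) {n : ℕ} {U : Opens X}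
    (θ : Matrix (Fin n) (Fin n) (T.Ω.val.obj (op U))) : (T.matrixForms n).val.obj (op U) :=
  ∑ i, ∑ j, tensorSec T.Ω.val (matPresheaf T.A n) (θ i j)
    (Matrix.single i j 1 : Matrix (Fin n) (Fin n) (T.A.obj.obj (op U)))

/-- The Maurer-Cartan differential `g ↦ g⁻¹ · d(g)`, where `d(g) = ∑ d(gᵢⱼ) ⊗ Eᵢⱼ`. -/
noncomputable def DifferentialTriad.maurerCartan (T : DifferentialTriad 𝕜 X) {n : ℕ} {U : Opens X}
    (g : Matrix.GeneralLinearGroup (Fin n) (T.A.obj.obj (op U))) :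
    (T.matrixForms n).val.obj (op U) :=
  ∑ i, ∑ j, tensorSec T.Ω.val (matPresheaf T.A n) (T.diff (g.val i j))
    ((g⁻¹).val * Matrix.single i j 1 : Matrix (Fin n) (Fin n) (T.A.obj.obj (op U)))

/-- Connections on a principal sheaf with structure sheaf `GL(n, A)`: morphisms of sheaves of sets
`D : P ⟶ Ω ⊗ M_n(A)` with `D(s · g) = Ad(g⁻¹) . D(s) + g⁻¹ · d(g)`. -/
structure PrincipalConnection (T : DifferentialTriad 𝕜 X) {n : ℕ}
    (P : PrincipalSheaf (GLSheaf T.A n)) where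
  toFun : ∀ U : Opens X, P.sheaf.obj.obj (op U) → (T.matrixForms n).val.obj (op U)
  map_res : ∀ {V U : Opens X} (h : V ≤ U) (s : P.sheaf.obj.obj (op U)),
    toFun V (setRes P.sheaf h s) = modRes (T.matrixForms n).val h (toFun U s)
  map_act : ∀ (U : Opens X) (s : P.sheaf.obj.obj (op U))
    (g : Matrix.GeneralLinearGroup (Fin n) (T.A.obj.obj (op U))),
    toFun U (P.act s g) = adAct T.Ω.val g⁻¹ (toFun U s) + T.maurerCartan g

end Connections

end ADG

/-! Everything is computed in local frames and then glued. Two frames over the same open set differ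
by a unique matrix `g` of `GL(n, A)`, and frames exist near every point. So a section of any sheaf
over `U` may be prescribed by its values on the frames over open subsets of `U`, provided these
values respect restriction and do not change under `f ↦ f · g` (`IsVectorSheaf.existsUnique_glue`).

(i) A frame `f` identifies the sections `a` of `Aⁿ` both with the classes `[f, a]` and with the
sections `f(a)` of `E`. The identity `(f · g)(g⁻¹ a) = f(a)` (`act_iso_frameCoord`) says that the
resulting correspondence is independent of the frame. It therefore glues in both directions, and it
is linear because each of the two identifications is.

(ii) The tensor product sheaves are sheafifications, but both have global coordinates where they are
needed. A frame `eᵢ` of `E` over `U` identifies `Ω(U)ⁿ` with the sections of `E ⊗ Ω` by `ω ↦ ∑ eᵢ ⊗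
ωᵢ` (`frameTensor`), and matrices of forms are the sections of `Ω ⊗ M_n(A)`
(`DifferentialTriad.ofMatrix_bijective`). The reason is `IsSh.bijective_comp`: in coordinates the
presheaf tensor product is a power of a sheaf, hence already a sheaf, and sheafification adds
nothing.

In these coordinates a connection on `E` reads `a ↦ θ a + da`, with `θ` its matrix on the frame
(`ModuleConnection.apply_iso`). For the frames `f` and `f · g`, the local expressions given by `θ`
and `θ'` describe the same operator exactly when `g θ' = θ g + dg`. Multiplied by `g⁻¹`, this is `θ'
= g⁻¹ θ g + g⁻¹ dg`, the transformation law of a connection on the sheaf of frames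
(`DifferentialTriad.adAct_add_maurerCartan_eq_iff`). Hence `D(f) = θ` defines a connection on
`P(E)`. Conversely, the forms of a connection on `P(E)` give local operators that agree in all
frames (`covDeriv_mulVec`) and glue to a connection on `E`. -/

namespace ADG

/-! ### Coordinates on tensor products with a free module -/

section Algebra

open TensorProduct

variable {R M N : Type*} [CommRing R] [AddCommGroup M] [Module R M] [AddCommGroup N] [Module R N]
  {n : ℕ}

/-- The vectors `L eᵢ` are a basis of `M`, so `M ⊗ N` is the direct sum of copies of `N` indexed by
them. -/
theorem bijective_sum_equiv_tmul (L : (Fin n → R) ≃ₗ[R] M) :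
    Function.Bijective (fun ω : Fin n → N => ∑ i, L (Pi.single i 1) ⊗ₜ[R] ω i) := by
  let b : Module.Basis (Fin n) R M := Module.Basis.ofEquivFun L.symm
  let e : (Fin n → N) ≃ M ⊗[R] N :=
    Finsupp.equivFunOnFinite.symm.trans (TensorProduct.equivFinsuppOfBasisLeft b).symm.toEquiv
  convert e.bijective using 2 with ω
  symm
  refine (TensorProduct.equivFinsuppOfBasisLeft_symm_apply b _).trans ?_
  rw [Finsupp.sum_fintype _ _ (fun i => by simp)]
  exact Finset.sum_congr rfl fun i _ => by simp [b]

theorem bijective_sum_tmul_single :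
    Function.Bijective (fun θ : Fin n → Fin n → N =>
      ∑ i, ∑ j, θ i j ⊗ₜ[R] (Matrix.single i j 1 : Matrix (Fin n) (Fin n) R)) := by
  let b := Matrix.stdBasis R (Fin n) (Fin n)
  let e : (Fin n → Fin n → N) ≃ N ⊗[R] Matrix (Fin n) (Fin n) R :=
    (Equiv.curry (Fin n) (Fin n) N).symm.trans (Finsupp.equivFunOnFinite.symm.trans
      (TensorProduct.equivFinsuppOfBasisRight b).symm.toEquiv)
  convert e.bijective using 2 with θ
  symm
  refine (TensorProduct.equivFinsuppOfBasisRight_symm_apply b _).trans ?_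
  rw [Finsupp.sum_fintype _ _ (fun i => by simp), Fintype.sum_prod_type]
  exact Finset.sum_congr rfl fun i _ => Finset.sum_congr rfl fun j _ => by
    simp [b, Matrix.stdBasis_eq_single]

/-- Moving the entries of `a` across the tensor sign gives the coordinates `aᵢⱼ ω` of a pure tensor
with respect to the matrix units. -/
theorem tmul_matrix_eq_sum (ω : N) (a : Matrix (Fin n) (Fin n) R) :
    ω ⊗ₜ[R] a = ∑ i, ∑ j, (a i j • ω) ⊗ₜ[R] (Matrix.single i j 1 : Matrix (Fin n) (Fin n) R) := by
  conv_lhs => rw [Matrix.matrix_eq_sum_single a]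
  simp only [TensorProduct.tmul_sum]
  refine Finset.sum_congr rfl fun i _ => Finset.sum_congr rfl fun j _ => ?_
  rw [TensorProduct.smul_tmul, Matrix.smul_single, smul_eq_mul, mul_one]

end Algebra

/-- A morphism from a sheaf that is bijective onto a presheaf over each open subset of `U` stays
bijective over `U` after composition with a locally bijective morphism to a sheaf. -/
theorem IsSh.bijective_comp {X : TopCat.{u}} {T S G : Opens X → Type u}
    {rT : ∀ {V U : Opens X}, V ≤ U → T U → T V}
    {rS : ∀ {V U : Opens X}, V ≤ U → S U → S V}
    {rG : ∀ {V U : Opens X}, V ≤ U → G U → G V}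
    (HS : IsSh S rS) (HG : IsSh G rG)
    (η : ∀ U, T U → S U)
    (η_res : ∀ {V U : Opens X} (h : V ≤ U) (t : T U), η V (rT h t) = rS h (η U t))
    (inj : ∀ {U : Opens X} (t t' : T U), η U t = η U t' →
      ∀ x ∈ U, ∃ (V : Opens X) (h : V ≤ U), x ∈ V ∧ rT h t = rT h t')
    (surj : ∀ {U : Opens X} (s : S U),
      ∀ x ∈ U, ∃ (V : Opens X) (h : V ≤ U), x ∈ V ∧ ∃ t, η V t = rS h s)
    {U : Opens X} (β : ∀ V, V ≤ U → G V → T V)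
    (β_res : ∀ {W V : Opens X} (h : W ≤ V) (k : V ≤ U) (g : G V),
      β W (h.trans k) (rG h g) = rT h (β V k g))
    (hβ : ∀ V k, Function.Bijective (β V k)) :
    Function.Bijective (fun g => η U (β U le_rfl g)) := by
  -- Sections with the same image in `S` agree locally in `T`, hence locally in `G` because `β` is
  -- injective, hence in `G`. This is proved over every `V ≤ U`, since the gluing below uses it on
  -- overlaps.
  have hinj : ∀ V (k : V ≤ U) (g g' : G V), η V (β V k g) = η V (β V k g') → g = g' := by
    intro V k g g' e
    refine HG.sep _ _ fun x hx => ?_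
    obtain ⟨W, h, hxW, e'⟩ := inj _ _ e x hx
    refine ⟨W, h, hxW, (hβ W (h.trans k)).1 ?_⟩
    rw [β_res h k, β_res h k, e']
  refine ⟨fun g g' e => hinj U le_rfl g g' e, fun w => ?_⟩
  -- Local lifts to `T` exist, and surjectivity of `β` carries them to `G`; by `hinj` they agree on
  -- overlaps, so they glue in the sheaf `G`.
  have loc : ∀ x : U, ∃ (V : Opens X) (h : V ≤ U), x.1 ∈ V ∧ ∃ g, η V (β V h g) = rS h w := by
    intro x
    obtain ⟨V, h, hxV, t, ht⟩ := surj w x.1 x.2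
    obtain ⟨g, rfl⟩ := (hβ V h).2 t
    exact ⟨V, h, hxV, g, ht⟩
  choose V hV hx g hg using loc
  obtain ⟨g', hg'⟩ := HG.glue V hV hx g (by
    intro x y W h k
    apply hinj W (h.trans (hV x))
    rw [β_res h (hV x), β_res k (hV y), η_res, η_res, hg, hg, HS.res_res, HS.res_res])
  refine ⟨g', HS.sep _ _ fun x hxU => ⟨V ⟨x, hxU⟩, hV _, hx _, ?_⟩⟩
  rw [← η_res, ← β_res (hV ⟨x, hxU⟩) le_rfl, hg', hg]

/-! ### Rules of calculation for the sections `s ⊗ t` -/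

section TensorSections

open TensorProduct

variable {X : TopCat.{u}} {A : Sheaf (Opens.grothendieckTopology X) CommRingCat.{u}}
  (M N : PresheafOfModules.{u} (A.obj ⋙ forget₂ CommRingCat RingCat))

theorem tensorSec_add_left {U : Opens X} (s s' : M.obj (op U)) (t : N.obj (op U)) :
    tensorSec M N (s + s') t = tensorSec M N s t + tensorSec M N s' t :=
  (congrArg (toTensorSheaf M N U) (TensorProduct.add_tmul (R := A.obj.obj (op U)) s s' t)).trans
    (map_add (toTensorSheaf M N U) _ _)

theorem tensorSec_add_right {U : Opens X} (s : M.obj (op U)) (t t' : N.obj (op U)) :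
    tensorSec M N s (t + t') = tensorSec M N s t + tensorSec M N s t' :=
  (congrArg (toTensorSheaf M N U) (TensorProduct.tmul_add (R := A.obj.obj (op U)) s t t')).trans
    (map_add (toTensorSheaf M N U) _ _)

theorem tensorSec_smul_right {U : Opens X} (r : A.obj.obj (op U)) (s : M.obj (op U))
    (t : N.obj (op U)) : tensorSec M N s (r • t) = r • tensorSec M N s t :=
  (congrArg (toTensorSheaf M N U) (TensorProduct.tmul_smul (R := A.obj.obj (op U)) r s t)).trans
    (map_smul (toTensorSheaf M N U) _ _)

theorem tensorSec_smul_left {U : Opens X} (r : A.obj.obj (op U)) (s : M.obj (op U))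
    (t : N.obj (op U)) : tensorSec M N (r • s) t = tensorSec M N s (r • t) :=
  congrArg (toTensorSheaf M N U) (TensorProduct.smul_tmul (R := A.obj.obj (op U)) r s t)

theorem tensorObj_res_tmul {V U : Opens X} (h : V ≤ U) (s : M.obj (op U)) (t : N.obj (op U)) :
    modRes (PresheafOfModules.Monoidal.tensorObj M N) h (s ⊗ₜ[A.obj.obj (op U)] t) =
      (modRes M h s ⊗ₜ[A.obj.obj (op V)] modRes N h t :) :=
  PresheafOfModules.Monoidal.tensorObj_map_tmul (M₁ := M) (M₂ := N) (homOfLE h).op s t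

theorem tensorSec_res {V U : Opens X} (h : V ≤ U) (s : M.obj (op U)) (t : N.obj (op U)) :
    modRes (tensorSheaf M N).val h (tensorSec M N s t) =
      tensorSec M N (modRes M h s) (modRes N h t) :=
  (tensor_res M N h _).symm.trans (congrArg (toTensorSheaf M N V) (tensorObj_res_tmul M N h s t))

end TensorSections
-- Coordinates on the two tensor product sheaves
section Coordinates

open TensorProduct

variable {X : TopCat.{u}} {A : Sheaf (Opens.grothendieckTopology X) CommRingCat.{u}}
  {E : SheafOfModules.{u} (ringSheaf A)} {n : ℕ} (N : SheafOfModules.{u} (ringSheaf A))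

/-- Over each open subset of `U` the frame identifies the presheaf tensor product with `Nⁿ`, which
is a sheaf; so the sections over `U` itself, and not only the germs, have coordinates. -/
theorem bijective_sum_basis_tensorSec {U : Opens X} (f : Frame E n U) :
    Function.Bijective (fun ω : Fin n → N.val.obj (op U) =>
      ∑ i, tensorSec E.val N.val (f.basis i) (ω i)) := by
  have key := IsSh.bijective_comp (isSh_module (tensorSheaf E.val N.val))
    ((isSh_module N).pi (Fin n))
    (T := fun U => (PresheafOfModules.Monoidal.tensorObj E.val N.val).obj (op U))
    (rT := fun h => modRes (PresheafOfModules.Monoidal.tensorObj E.val N.val) h)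
    (fun U => toTensorSheaf E.val N.val U) (tensor_res _ _)
    (toTensorSheaf_inj _ _) (toTensorSheaf_surj _ _) (U := U)
    (fun V h ω => (∑ i, (f.res h).basis i ⊗ₜ[A.obj.obj (op V)] ω i :)) ?_ ?_
  · refine (congrArg Function.Bijective (funext fun ω => ?_)).mp key
    exact map_sum (toTensorSheaf E.val N.val U) _ _
  · intro W V h k ω
    refine Eq.trans ?_ (map_sum (modRes (PresheafOfModules.Monoidal.tensorObj E.val N.val) h)
      (fun i => ((f.res k).basis i ⊗ₜ[A.obj.obj (op V)] ω i :)) Finset.univ).symm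
    refine Finset.sum_congr rfl fun i _ => ?_
    refine Eq.trans ?_ (tensorObj_res_tmul E.val N.val h _ _).symm
    rw [← Frame.basis_res]
    rfl
  · intro V h
    exact bijective_sum_equiv_tmul ((f.res h).iso V le_rfl)

/-- The same argument as for a frame of `E`, with the matrix units as a basis; these exist over
every open set, so no local triviality is involved. -/
theorem bijective_sum_tensorSec_single (U : Opens X) :
    Function.Bijective (fun θ : Matrix (Fin n) (Fin n) (N.val.obj (op U)) =>
      ∑ i, ∑ j, tensorSec N.val (matPresheaf A n) (θ i j)
        (Matrix.single i j 1 : Matrix (Fin n) (Fin n) (A.obj.obj (op U)))) := by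
  have key := IsSh.bijective_comp (isSh_module (tensorSheaf N.val (matPresheaf A n)))
    (((isSh_module N).pi (Fin n)).pi (Fin n))
    (T := fun U => (PresheafOfModules.Monoidal.tensorObj N.val (matPresheaf A n)).obj (op U))
    (rT := fun h => modRes (PresheafOfModules.Monoidal.tensorObj N.val (matPresheaf A n)) h)
    (fun U => toTensorSheaf N.val (matPresheaf A n) U) (tensor_res _ _)
    (toTensorSheaf_inj _ _) (toTensorSheaf_surj _ _) (U := U)
    (fun V h θ => (∑ i, ∑ j, θ i j ⊗ₜ[A.obj.obj (op V)]
      (Matrix.single i j 1 : Matrix (Fin n) (Fin n) (A.obj.obj (op V))) :)) ?_ ?_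
  · refine (congrArg Function.Bijective (funext fun θ => ?_)).mp key
    refine ((map_sum (toTensorSheaf N.val (matPresheaf A n) U) _ _).trans ?_)
    exact Finset.sum_congr rfl fun i _ => map_sum (toTensorSheaf N.val (matPresheaf A n) U) _ _
  · intro W V h k θ
    let r := modRes (PresheafOfModules.Monoidal.tensorObj N.val (matPresheaf A n)) h
    refine Eq.trans ?_ (map_sum r (fun i => (∑ j, θ i j ⊗ₜ[A.obj.obj (op V)]
      (Matrix.single i j 1 : Matrix (Fin n) (Fin n) (A.obj.obj (op V))) :)) Finset.univ).symm
    refine Finset.sum_congr rfl fun i _ => ?_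
    refine Eq.trans ?_ (map_sum r (fun j => (θ i j ⊗ₜ[A.obj.obj (op V)]
      (Matrix.single i j 1 : Matrix (Fin n) (Fin n) (A.obj.obj (op V))) :)) Finset.univ).symm
    refine Finset.sum_congr rfl fun j _ => ?_
    refine Eq.trans ?_ (tensorObj_res_tmul N.val (matPresheaf A n) h _ _).symm
    refine congrArg (fun a : Matrix (Fin n) (Fin n) (A.obj.obj (op W)) =>
      modRes N.val h (θ i j) ⊗ₜ[A.obj.obj (op W)] a) ?_
    -- Restriction of matrices is entrywise, so it sends matrix units to matrix units.
    change _ = (Matrix.single i j 1 : Matrix (Fin n) (Fin n) (A.obj.obj (op V))).map (ringRes A h)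
    rw [Matrix.map_single, map_one]
  · intro V h
    exact bijective_sum_tmul_single

/-- Sections of `E ⊗ N` in terms of a frame of `E`: `ω ↦ ∑ eᵢ ⊗ ωᵢ`. -/
noncomputable def frameTensor {U : Opens X} (f : Frame E n U) :
    (Fin n → N.val.obj (op U)) ≃ₗ[A.obj.obj (op U)] (tensorSheaf E.val N.val).val.obj (op U) :=
  LinearEquiv.ofBijective
    { toFun := fun ω => ∑ i, tensorSec E.val N.val (f.basis i) (ω i)
      map_add' := fun ω ω' => by
        simp only [Pi.add_apply, tensorSec_add_right, Finset.sum_add_distrib]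
      map_smul' := fun r ω => by
        simp only [Pi.smul_apply, tensorSec_smul_right, Finset.smul_sum, RingHom.id_apply] }
    (bijective_sum_basis_tensorSec N f)

theorem frameTensor_apply {U : Opens X} (f : Frame E n U) (ω : Fin n → N.val.obj (op U)) :
    frameTensor N f ω = ∑ i, tensorSec E.val N.val (f.basis i) (ω i) := rfl

theorem frameTensor_res {V U : Opens X} (h : V ≤ U) (f : Frame E n U)
    (ω : Fin n → N.val.obj (op U)) :
    modRes (tensorSheaf E.val N.val).val h (frameTensor N f ω) =
      frameTensor N (f.res h) (fun i => modRes N.val h (ω i)) := by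
  rw [frameTensor_apply, frameTensor_apply]
  refine (map_sum (modRes (tensorSheaf E.val N.val).val h) _ _).trans
    (Finset.sum_congr rfl fun i _ => ?_)
  rw [tensorSec_res, Frame.basis_res]

/-- The coefficients of `∑ aᵢ eᵢ` move to the right factor: `(∑ aᵢ eᵢ) ⊗ ω = ∑ eᵢ ⊗ aᵢ ω`. -/
theorem tensorSec_iso {U : Opens X} (f : Frame E n U) (a : Fin n → A.obj.obj (op U))
    (ω : N.val.obj (op U)) :
    tensorSec E.val N.val (f.iso U le_rfl a) ω = frameTensor N f (fun i => a i • ω) := by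
  rw [Frame.iso_apply, frameTensor_apply]
  let τ : E.val.obj (op U) →+ (tensorSheaf E.val N.val).val.obj (op U) :=
    AddMonoidHom.mk' (fun s => tensorSec E.val N.val s ω) fun s s' => tensorSec_add_left _ _ s s' ω
  refine (map_sum τ _ _).trans (Finset.sum_congr rfl fun i _ => ?_)
  refine (tensorSec_smul_left E.val N.val (a i) _ ω).trans ?_
  exact congrArg (fun s => tensorSec E.val N.val s (a i • ω))
    ((isSh_module E).res_self (f.basis i))

/-- The vectors of `f · g` are the combinations of those of `f` given by the columns of `g`, so
coordinates with respect to `f · g` are multiplied by `g` to give those with respect to `f`. -/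
theorem frameTensor_act {U : Opens X} (f : Frame E n U)
    (g : Matrix.GeneralLinearGroup (Fin n) (A.obj.obj (op U))) (ω : Fin n → N.val.obj (op U)) :
    frameTensor N (f.act g) ω = frameTensor N f (fun i => ∑ l, g.val i l • ω l) := by
  have e : ∀ l, tensorSec E.val N.val ((f.act g).basis l) (ω l) =
      frameTensor N f (fun i => g.val i l • ω l) := by
    intro l
    rw [Frame.act_basis, tensorSec_iso]
    refine congrArg (frameTensor N f) (funext fun i => ?_)
    rw [Matrix.mulVec_single_one, Matrix.col_apply]
  rw [frameTensor_apply, Finset.sum_congr rfl fun l _ => e l, ← map_sum]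
  refine congrArg (frameTensor N f) (funext fun i => ?_)
  rw [Finset.sum_apply]

end Coordinates
-- Matrices of forms, the adjoint action and the Maurer-Cartan differential
section MatrixForms

open TensorProduct

/-- `adAct` is chosen from a unique existence statement over all smaller open sets; this makes it
computable on sections coming from the presheaf tensor product. -/
theorem adAct_toTensorSheaf {X : TopCat.{u}}
    {A : Sheaf (Opens.grothendieckTopology X) CommRingCat.{u}} {n : ℕ}
    (M : PresheafOfModules.{u} (A.obj ⋙ forget₂ CommRingCat RingCat)) {U : Opens X}
    (g : Matrix.GeneralLinearGroup (Fin n) (A.obj.obj (op U)))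
    (t : (PresheafOfModules.Monoidal.tensorObj M (matPresheaf A n)).obj (op U)) :
    adAct M g (toTensorSheaf M (matPresheaf A n) U t) =
      toTensorSheaf M (matPresheaf A n) U (adTensor M g t) := by
  have HS := isSh_module (tensorSheaf M (matPresheaf A n))
  -- The characterization is applied over `U` itself, where `w` and `g` appear restricted along `U ≤
  -- U`; `res_self` and `eg` remove these restrictions.
  have e := (ad_existsUnique M g (toTensorSheaf M (matPresheaf A n) U t)).choose_spec.1 U le_rfl t
    (HS.res_self _).symm
  have eg : Matrix.GeneralLinearGroup.map (ringRes A (le_refl U)) g = g :=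
    ConcreteCategory.congr_hom ((GLPresheaf A n).map_id (op U)) g
  rw [eg] at e
  exact (HS.res_self _).symm.trans e

variable {𝕜 : Type} [RCLike 𝕜] {X : TopCat.{u}} (T : DifferentialTriad 𝕜 X) {n : ℕ} {U : Opens X}

/-- The section `ω ⊗ a` of `Ω ⊗ M_n(A)`. -/
noncomputable def DifferentialTriad.matTensor (ω : T.Ω.val.obj (op U))
    (a : Matrix (Fin n) (Fin n) (T.A.obj.obj (op U))) : (T.matrixForms n).val.obj (op U) :=
  tensorSec T.Ω.val (matPresheaf T.A n) ω a

theorem DifferentialTriad.ofMatrix_eq_sum (θ : Matrix (Fin n) (Fin n) (T.Ω.val.obj (op U))) :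
    T.ofMatrix θ = ∑ i, ∑ j, T.matTensor (θ i j) (Matrix.single i j 1) := rfl

theorem DifferentialTriad.maurerCartan_eq_sum
    (g : Matrix.GeneralLinearGroup (Fin n) (T.A.obj.obj (op U))) :
    T.maurerCartan g =
      ∑ i, ∑ j, T.matTensor (T.diff (g.val i j)) ((g⁻¹).val * Matrix.single i j 1) := rfl

theorem DifferentialTriad.matTensor_add (ω ω' : T.Ω.val.obj (op U))
    (a : Matrix (Fin n) (Fin n) (T.A.obj.obj (op U))) :
    T.matTensor (ω + ω') a = T.matTensor ω a + T.matTensor ω' a :=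
  tensorSec_add_left T.Ω.val (matPresheaf T.A n) ω ω' a

theorem DifferentialTriad.ofMatrix_add (θ θ' : Matrix (Fin n) (Fin n) (T.Ω.val.obj (op U))) :
    T.ofMatrix (θ + θ') = T.ofMatrix θ + T.ofMatrix θ' := by
  simp only [T.ofMatrix_eq_sum, Matrix.add_apply, T.matTensor_add, Finset.sum_add_distrib]

/-- Every section of `Ω ⊗ M_n(A)`, over any open set, is a unique matrix of forms, so the law of a
connection on `P(E)` becomes an identity of matrices. -/
theorem DifferentialTriad.ofMatrix_bijective : Function.Bijective
    (T.ofMatrix : Matrix (Fin n) (Fin n) (T.Ω.val.obj (op U)) → _) :=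
  bijective_sum_tensorSec_single T.Ω U

theorem DifferentialTriad.ofMatrix_sum {ι : Type*} (s : Finset ι)
    (θ : ι → Matrix (Fin n) (Fin n) (T.Ω.val.obj (op U))) :
    T.ofMatrix (∑ k ∈ s, θ k) = ∑ k ∈ s, T.ofMatrix (θ k) :=
  map_sum (AddMonoidHom.mk' T.ofMatrix T.ofMatrix_add) θ s

theorem DifferentialTriad.toTensorSheaf_sum
    (t : Fin n → Fin n → T.Ω.val.obj (op U) ⊗[T.A.obj.obj (op U)]
      Matrix (Fin n) (Fin n) (T.A.obj.obj (op U))) :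
    toTensorSheaf T.Ω.val (matPresheaf T.A n) U (∑ i, ∑ j, t i j :) =
      ∑ i, ∑ j, toTensorSheaf T.Ω.val (matPresheaf T.A n) U (t i j) := by
  refine (map_sum (toTensorSheaf T.Ω.val (matPresheaf T.A n) U) _ _).trans ?_
  exact Finset.sum_congr rfl fun i _ =>
    map_sum (toTensorSheaf T.Ω.val (matPresheaf T.A n) U) _ _

theorem DifferentialTriad.matTensor_eq_ofMatrix (ω : T.Ω.val.obj (op U))
    (a : Matrix (Fin n) (Fin n) (T.A.obj.obj (op U))) :
    T.matTensor ω a = T.ofMatrix (Matrix.of fun i j => a i j • ω) :=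
  (congrArg (toTensorSheaf T.Ω.val (matPresheaf T.A n) U) (tmul_matrix_eq_sum ω a)).trans
    (T.toTensorSheaf_sum _)

theorem DifferentialTriad.ofMatrix_res {V : Opens X} (h : V ≤ U)
    (θ : Matrix (Fin n) (Fin n) (T.Ω.val.obj (op U))) :
    modRes (T.matrixForms n).val h (T.ofMatrix θ) =
      T.ofMatrix (Matrix.of fun i j => modRes T.Ω.val h (θ i j)) := by
  refine (map_sum (modRes (T.matrixForms n).val h) _ _).trans
    (Finset.sum_congr rfl fun i _ => ?_)
  refine (map_sum (modRes (T.matrixForms n).val h) _ _).trans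
    (Finset.sum_congr rfl fun j _ => ?_)
  refine (tensorSec_res _ _ h _ _).trans ?_
  refine congrArg (T.matTensor (modRes T.Ω.val h (θ i j))) ?_
  change (Matrix.single i j 1 : Matrix (Fin n) (Fin n) (T.A.obj.obj (op U))).map (ringRes T.A h) = _
  rw [Matrix.map_single, map_one]

theorem DifferentialTriad.adAct_ofMatrix_eq_sum
    (g : Matrix.GeneralLinearGroup (Fin n) (T.A.obj.obj (op U)))
    (θ : Matrix (Fin n) (Fin n) (T.Ω.val.obj (op U))) :
    adAct T.Ω.val g (T.ofMatrix θ) =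
      ∑ i, ∑ j, T.matTensor (θ i j) (g.val * Matrix.single i j 1 * (g⁻¹).val) := by
  refine (congrArg (adAct T.Ω.val g) (T.toTensorSheaf_sum fun i j => θ i j ⊗ₜ
    (Matrix.single i j 1 : Matrix (Fin n) (Fin n) (T.A.obj.obj (op U)))).symm).trans ?_
  refine (adAct_toTensorSheaf _ _ _).trans (Eq.trans ?_ (T.toTensorSheaf_sum fun i j => θ i j ⊗ₜ
    (g.val * Matrix.single i j 1 * (g⁻¹).val : Matrix (Fin n) (Fin n) (T.A.obj.obj (op U)))))
  refine congrArg (toTensorSheaf T.Ω.val (matPresheaf T.A n) U) ?_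
  refine (map_sum (adTensor T.Ω.val g) _ _).trans (Finset.sum_congr rfl fun i _ => ?_)
  exact map_sum (adTensor T.Ω.val g) _ _

theorem mul_single_mul_apply {R : Type*} [CommRing R] (p q : Matrix (Fin n) (Fin n) R)
    (i j l m : Fin n) :
    (p * (Matrix.single i j 1 : Matrix (Fin n) (Fin n) R) * q) l m = p l i * q j m := by
  rw [Matrix.mul_apply, Finset.sum_eq_single j]
  · rw [Matrix.mul_single_apply_same, mul_one]
  · intro k _ hk
    rw [Matrix.mul_single_apply_of_ne _ _ _ _ _ hk, zero_mul]
  · intro h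
    exact absurd (Finset.mem_univ j) h

/-- In matrices of forms the adjoint action is conjugation, `θ ↦ g θ g⁻¹`. -/
theorem DifferentialTriad.adAct_ofMatrix
    (g : Matrix.GeneralLinearGroup (Fin n) (T.A.obj.obj (op U)))
    (θ : Matrix (Fin n) (Fin n) (T.Ω.val.obj (op U))) :
    adAct T.Ω.val g (T.ofMatrix θ) =
      T.ofMatrix (Matrix.of fun l m => ∑ i, ∑ j, (g.val l i * (g⁻¹).val j m) • θ i j) := by
  rw [T.adAct_ofMatrix_eq_sum]
  simp only [T.matTensor_eq_ofMatrix, ← T.ofMatrix_sum]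
  refine congrArg T.ofMatrix (Matrix.ext fun l m => ?_)
  simp only [Matrix.sum_apply, Matrix.of_apply, mul_single_mul_apply]

/-- The entries of the matrix product `g⁻¹ dg`: multiplied by `g⁻¹` on the left, the unit with
indices `i, j` only contributes to column `j`. -/
theorem DifferentialTriad.maurerCartan_eq_ofMatrix
    (g : Matrix.GeneralLinearGroup (Fin n) (T.A.obj.obj (op U))) :
    T.maurerCartan g =
      T.ofMatrix (Matrix.of fun l m => ∑ i, (g⁻¹).val l i • T.diff (g.val i m)) := by
  rw [T.maurerCartan_eq_sum]
  simp only [T.matTensor_eq_ofMatrix, ← T.ofMatrix_sum]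
  refine congrArg T.ofMatrix (Matrix.ext fun l m => ?_)
  simp only [Matrix.sum_apply, Matrix.of_apply]
  refine Finset.sum_congr rfl fun i _ => ?_
  rw [Finset.sum_eq_single m]
  · rw [Matrix.mul_single_apply_same, mul_one]
  · intro j _ hj
    rw [Matrix.mul_single_apply_of_ne _ _ _ _ _ hj.symm, zero_smul]
  · intro h
    exact absurd (Finset.mem_univ m) h

/-- The matrix of forms `θ g + dg`. -/
noncomputable def DifferentialTriad.twist (T : DifferentialTriad 𝕜 X)
    (g : Matrix (Fin n) (Fin n) (T.A.obj.obj (op U)))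
    (θ : Matrix (Fin n) (Fin n) (T.Ω.val.obj (op U))) :
    Matrix (Fin n) (Fin n) (T.Ω.val.obj (op U)) :=
  Matrix.of fun i m => ∑ j, g j m • θ i j + T.diff (g i m)

/-- Factoring out `g⁻¹`: `g⁻¹ θ g + g⁻¹ dg = g⁻¹ (θ g + dg)`. -/
theorem DifferentialTriad.adAct_add_maurerCartan
    (g : Matrix.GeneralLinearGroup (Fin n) (T.A.obj.obj (op U)))
    (θ : Matrix (Fin n) (Fin n) (T.Ω.val.obj (op U))) :
    adAct T.Ω.val g⁻¹ (T.ofMatrix θ) + T.maurerCartan g =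
      T.ofMatrix (Matrix.of fun l m => ∑ i, (g⁻¹).val l i • T.twist g.val θ i m) := by
  rw [T.adAct_ofMatrix, T.maurerCartan_eq_ofMatrix, ← T.ofMatrix_add]
  refine congrArg T.ofMatrix (Matrix.ext fun l m => ?_)
  simp only [Matrix.add_apply, DifferentialTriad.twist, Matrix.of_apply, smul_add,
    Finset.sum_add_distrib, Finset.smul_sum, smul_smul, inv_inv]

/-- An invertible matrix can be moved to the other side of `g v = w`, also when the vectors have
entries in a module. -/
theorem sum_smul_eq_iff {R M : Type*} [CommRing R] [AddCommGroup M] [Module R M]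
    (g : Matrix.GeneralLinearGroup (Fin n) R) (v w : Fin n → M) :
    (∀ i, ∑ l, g.val i l • v l = w i) ↔ ∀ l, v l = ∑ i, (g⁻¹).val l i • w i := by
  have key : ∀ (p q : Matrix (Fin n) (Fin n) R) (_ : p * q = 1) (v : Fin n → M) (i : Fin n),
      ∑ l, p i l • ∑ k, q l k • v k = v i := by
    intro p q h v i
    simp only [Finset.smul_sum, smul_smul]
    rw [Finset.sum_comm]
    simp only [← Finset.sum_smul, ← Matrix.mul_apply, h, Matrix.one_apply, ite_smul, one_smul,
      zero_smul, Finset.sum_ite_eq, Finset.mem_univ, if_true]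
  constructor
  · intro h l
    simp only [← h]
    exact (key _ _ g.inv_val v l).symm
  · intro h i
    simp only [h]
    exact key _ _ g.val_inv w i

/-- The change of frame formula `g θ' = θ g + dg` for matrices of forms. -/
theorem DifferentialTriad.adAct_add_maurerCartan_eq_iff
    (g : Matrix.GeneralLinearGroup (Fin n) (T.A.obj.obj (op U)))
    (θ θ' : Matrix (Fin n) (Fin n) (T.Ω.val.obj (op U))) :
    T.ofMatrix θ' = adAct T.Ω.val g⁻¹ (T.ofMatrix θ) + T.maurerCartan g ↔
      ∀ i m, ∑ l, g.val i l • θ' l m = T.twist g.val θ i m := by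
  -- Both sides are compared column by column; `forall_comm` brings the column index to the front
  -- for `sum_smul_eq_iff` and then back.
  rw [T.adAct_add_maurerCartan, T.ofMatrix_bijective.1.eq_iff, forall_comm,
    forall_congr' fun m => sum_smul_eq_iff g (fun l => θ' l m) (fun i => T.twist g.val θ i m),
    forall_comm]
  exact Matrix.ext_iff.symm

end MatrixForms
-- Gluing along local frames
section FrameGluing

variable {X : TopCat.{u}} {A : Sheaf (Opens.grothendieckTopology X) CommRingCat.{u}}
  {E : SheafOfModules.{u} (ringSheaf A)} {n : ℕ}

/-- Sections of a sheaf given by local frames of a vector sheaf, independently of the frame. -/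
theorem IsVectorSheaf.existsUnique_glue (hE : IsVectorSheaf E n) {G : Opens X → Type u}
    {rG : ∀ {V U : Opens X}, V ≤ U → G U → G V} (HG : IsSh G rG) {U : Opens X}
    (m : ∀ V, V ≤ U → Frame E n V → G V)
    (m_res : ∀ {W V : Opens X} (h : W ≤ V) (k : V ≤ U) (f : Frame E n V),
      m W (h.trans k) (f.res h) = rG h (m V k f))
    (m_act : ∀ {V : Opens X} (k : V ≤ U) (f : Frame E n V)
      (g : Matrix.GeneralLinearGroup (Fin n) (A.obj.obj (op V))), m V k (f.act g) = m V k f) :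
    ∃! w : G U, ∀ (V : Opens X) (k : V ≤ U) (f : Frame E n V), rG k w = m V k f := by
  -- The structure group acts transitively on the frames over one open set, so invariance under the
  -- action is independence of the frame.
  have indep : ∀ (V : Opens X) (k : V ≤ U) (f f' : Frame E n V), m V k f = m V k f' := by
    intro V k f f'
    obtain ⟨g, rfl⟩ := f.act_bijective.2 f'
    exact (m_act k f g).symm
  have loc : ∀ x : U, ∃ (V : Opens X) (_ : V ≤ U), x.1 ∈ V ∧ Nonempty (Frame E n V) := by
    intro x
    obtain ⟨W, hxW, ⟨f⟩⟩ := hE x.1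
    exact ⟨W ⊓ U, inf_le_right, ⟨hxW, x.2⟩, ⟨f.res inf_le_left⟩⟩
  choose V hV hx hf using loc
  let f : ∀ x, Frame E n (V x) := fun x => (hf x).some
  obtain ⟨w, hw⟩ := HG.glue V hV hx (fun x => m _ (hV x) (f x)) (by
    intro x y W h k
    rw [← m_res h (hV x), ← m_res k (hV y)]
    exact indep _ _ _ _)
  refine ⟨w, fun W k f' => ?_, fun w' hw' => ?_⟩
  · refine HG.sep _ _ fun x hxW => ⟨V ⟨x, k hxW⟩ ⊓ W, inf_le_right, ⟨hx _, hxW⟩, ?_⟩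
    rw [HG.res_res, ← HG.res_res inf_le_left (hV ⟨x, k hxW⟩), hw, ← m_res inf_le_left (hV _),
      ← m_res inf_le_right k]
    exact indep _ _ _ _
  · refine HG.sep _ _ fun x hxU => ⟨V ⟨x, hxU⟩, hV _, hx _, ?_⟩
    rw [hw, hw' _ _ (f ⟨x, hxU⟩)]

/-- The open sets that carry a frame cover `U`, so it is enough to compare restrictions to them. -/
theorem IsVectorSheaf.eq_of_frames (hE : IsVectorSheaf E n) {G : Opens X → Type u}
    {rG : ∀ {V U : Opens X}, V ≤ U → G U → G V} (HG : IsSh G rG) {U : Opens X} (w w' : G U)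
    (H : ∀ (V : Opens X) (k : V ≤ U), Frame E n V → rG k w = rG k w') : w = w' := by
  refine HG.sep _ _ fun x hxU => ?_
  obtain ⟨W, hxW, ⟨f⟩⟩ := hE x
  exact ⟨W ⊓ U, inf_le_right, ⟨hxW, hxU⟩, H _ _ (f.res inf_le_left)⟩

theorem Frame.act_iso {U : Opens X} (f : Frame E n U)
    (g : Matrix.GeneralLinearGroup (Fin n) (A.obj.obj (op U))) (a : Fin n → A.obj.obj (op U)) :
    (f.act g).iso U le_rfl a = f.iso U le_rfl (g.val.mulVec a) := by
  have e : Matrix.GeneralLinearGroup.map (ringRes A (le_refl U)) g = g :=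
    ConcreteCategory.congr_hom ((GLPresheaf A n).map_id (op U)) g
  change f.iso U le_rfl ((Matrix.GeneralLinearGroup.map (ringRes A (le_refl U)) g).val.mulVec _) = _
  rw [e]

theorem Frame.res_iso {V U : Opens X} (h : V ≤ U) (f : Frame E n U)
    (a : Fin n → A.obj.obj (op U)) :
    (f.res h).iso V le_rfl (fun i => ringRes A h (a i)) = modRes E.val h (f.iso U le_rfl a) :=
  f.iso_res V U h le_rfl a

theorem Frame.res_iso_symm {V U : Opens X} (h : V ≤ U) (f : Frame E n U)
    (s : E.val.obj (op U)) :
    ((f.res h).iso V le_rfl).symm (modRes E.val h s) =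
      fun i => ringRes A h ((f.iso U le_rfl).symm s i) := by
  rw [LinearEquiv.symm_apply_eq, Frame.res_iso, LinearEquiv.apply_symm_apply]

end FrameGluing

/-! ### The sheaf associated with the sheaf of frames is `E` -/

section AssociatedToFrames

variable {X : TopCat.{u}} {A : Sheaf (Opens.grothendieckTopology X) CommRingCat.{u}}
  (E : SheafOfModules.{u} (ringSheaf A)) {n : ℕ} (hE : IsVectorSheaf E n)

/-- Sections of the sheaf associated with the sheaf of frames. -/
abbrev FrameAssoc (U : Opens X) : Type u :=
  (assocSet (frameSheaf E n hE) (𝟙 (GLSheaf A n))).obj.obj (op U)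

/-- The class `[f, a]` of a frame and a section of `Aⁿ`. -/
noncomputable def frameCls {U : Opens X} (f : Frame E n U) (a : Fin n → A.obj.obj (op U)) :
    FrameAssoc E hE U :=
  cls (frameSheaf E n hE) (𝟙 (GLSheaf A n)) f a

/-- The coordinates of a section of the associated sheaf with respect to a frame. -/
noncomputable def frameCoord {U : Opens X} (f : Frame E n U) (w : FrameAssoc E hE U) :
    Fin n → A.obj.obj (op U) :=
  coord (frameSheaf E n hE) (𝟙 (GLSheaf A n)) f w

/-- Restriction of sections of the sheaf associated with the sheaf of frames. -/
noncomputable def frameAssocRes {V U : Opens X} (h : V ≤ U) (w : FrameAssoc E hE U) :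
    FrameAssoc E hE V :=
  setRes (assocSet (frameSheaf E n hE) (𝟙 (GLSheaf A n))) h w

theorem isSh_frameAssoc : IsSh (FrameAssoc E hE) (fun h => frameAssocRes E hE h) :=
  isSh_set (assocSet (frameSheaf E n hE) (𝟙 (GLSheaf A n)))

variable {E}

theorem frameCls_frameCoord {U : Opens X} (f : Frame E n U) (w : FrameAssoc E hE U) :
    frameCls E hE f (frameCoord E hE f w) = w :=
  cls_coord (frameSheaf E n hE) (𝟙 (GLSheaf A n)) f w

theorem frameCoord_frameCls {U : Opens X} (f : Frame E n U) (a : Fin n → A.obj.obj (op U)) :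
    frameCoord E hE f (frameCls E hE f a) = a :=
  coord_cls (frameSheaf E n hE) (𝟙 (GLSheaf A n)) f a

theorem frameCls_res {V U : Opens X} (h : V ≤ U) (f : Frame E n U)
    (a : Fin n → A.obj.obj (op U)) :
    frameAssocRes E hE h (frameCls E hE f a) =
      frameCls E hE (f.res h) (fun i => ringRes A h (a i)) :=
  cls_res (frameSheaf E n hE) (𝟙 (GLSheaf A n)) h f a

theorem frameCoord_res {V U : Opens X} (h : V ≤ U) (f : Frame E n U) (w : FrameAssoc E hE U) :
    frameCoord E hE (f.res h) (frameAssocRes E hE h w) =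
      fun i => ringRes A h (frameCoord E hE f w i) :=
  coord_res (frameSheaf E n hE) (𝟙 (GLSheaf A n)) h f w

theorem frameCoord_act {U : Opens X} (f : Frame E n U)
    (g : Matrix.GeneralLinearGroup (Fin n) (A.obj.obj (op U))) (w : FrameAssoc E hE U) :
    frameCoord E hE (f.act g) w = (g⁻¹).val.mulVec (frameCoord E hE f w) :=
  coord_act (frameSheaf E n hE) (𝟙 (GLSheaf A n)) f g w

theorem frameCoord_add {U : Opens X} (f : Frame E n U) (w w' : FrameAssoc E hE U) :
    frameCoord E hE f (w + w') = frameCoord E hE f w + frameCoord E hE f w' :=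
  coord_add (frameSheaf E n hE) (𝟙 (GLSheaf A n)) f w w'

theorem frameCoord_smul {U : Opens X} (f : Frame E n U) (r : A.obj.obj (op U))
    (w : FrameAssoc E hE U) : frameCoord E hE f (r • w) = r • frameCoord E hE f w :=
  coord_smul (frameSheaf E n hE) (𝟙 (GLSheaf A n)) f r w

/-- The cancellation `(f · g)(g⁻¹ a) = f(a)`, which makes `[f, a] ↦ f(a)` independent of the frame.
-/
theorem act_iso_frameCoord {U : Opens X} (f : Frame E n U)
    (g : Matrix.GeneralLinearGroup (Fin n) (A.obj.obj (op U))) (w : FrameAssoc E hE U) :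
    (f.act g).iso U le_rfl (frameCoord E hE (f.act g) w) =
      f.iso U le_rfl (frameCoord E hE f w) := by
  rw [Frame.act_iso, frameCoord_act, Matrix.mulVec_mulVec, ← Units.val_mul, mul_inv_cancel,
    Units.val_one, Matrix.one_mulVec]

/-- `w` and `s` have the same coordinates with respect to all local frames. -/
def SameCoord {U : Opens X} (w : FrameAssoc E hE U) (s : E.val.obj (op U)) : Prop :=
  ∀ (V : Opens X) (k : V ≤ U) (f : Frame E n V),
    modRes E.val k s = f.iso V le_rfl (frameCoord E hE f (frameAssocRes E hE k w))

/-- If `w = [f, a]` over `V`, the candidate there is `f(a)`; these candidates do not depend on `f`,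
so they glue. -/
theorem existsUnique_sameCoord {U : Opens X} (w : FrameAssoc E hE U) :
    ∃! s, SameCoord hE w s := by
  refine hE.existsUnique_glue (isSh_module E)
    (fun V k f => f.iso V le_rfl (frameCoord E hE f (frameAssocRes E hE k w))) ?_ ?_
  · intro W V h k f
    rw [← (isSh_frameAssoc E hE).res_res h k, frameCoord_res, Frame.res_iso]
  · intro V k f g
    exact act_iso_frameCoord hE f g _

/-- In the other direction the local candidates are the classes `[f, f⁻¹(s)]`. -/
theorem existsUnique_sameCoord' {U : Opens X} (s : E.val.obj (op U)) :
    ∃! w, SameCoord hE w s := by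
  obtain ⟨w, hw, huniq⟩ := hE.existsUnique_glue (isSh_frameAssoc E hE)
    (fun V k f => frameCls E hE f ((f.iso V le_rfl).symm (modRes E.val k s)))
    (by
      intro W V h k f
      rw [frameCls_res, ← Frame.res_iso_symm, (isSh_module E).res_res])
    (by
      intro V k f g
      -- The class formed with `f` is rewritten in coordinates with respect to `f · g`, so that only
      -- coordinates in one frame remain to be compared.
      rw [← frameCls_frameCoord hE (f.act g)
        (frameCls E hE f ((f.iso V le_rfl).symm (modRes E.val k s)))]
      refine congrArg _ ?_
      rw [LinearEquiv.symm_apply_eq, act_iso_frameCoord, frameCoord_frameCls,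
        LinearEquiv.apply_symm_apply])
  have iff : ∀ w' : FrameAssoc E hE U, SameCoord hE w' s ↔ ∀ (V : Opens X) (k : V ≤ U)
      (f : Frame E n V), frameAssocRes E hE k w' =
        frameCls E hE f ((f.iso V le_rfl).symm (modRes E.val k s)) := by
    intro w'
    refine forall_congr' fun V => forall_congr' fun k => forall_congr' fun f => ?_
    constructor
    · intro e
      rw [e, LinearEquiv.symm_apply_apply, frameCls_frameCoord]
    · intro e
      rw [e, frameCoord_frameCls, LinearEquiv.apply_symm_apply]
  exact ⟨w, (iff w).2 hw, fun w' hw' => huniq w' ((iff w').1 hw')⟩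

theorem SameCoord.res {V U : Opens X} (h : V ≤ U) {w : FrameAssoc E hE U}
    {s : E.val.obj (op U)} (e : SameCoord hE w s) :
    SameCoord hE (frameAssocRes E hE h w) (modRes E.val h s) := by
  intro W k f
  rw [(isSh_module E).res_res, (isSh_frameAssoc E hE).res_res]
  exact e W _ f

theorem SameCoord.add {U : Opens X} {w w' : FrameAssoc E hE U} {s s' : E.val.obj (op U)}
    (e : SameCoord hE w s) (e' : SameCoord hE w' s') : SameCoord hE (w + w') (s + s') := by
  intro V k f
  have r : frameAssocRes E hE k (w + w') = frameAssocRes E hE k w + frameAssocRes E hE k w' :=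
    assoc_res_add (frameSheaf E n hE) (𝟙 (GLSheaf A n)) k w w'
  rw [r, frameCoord_add, map_add, map_add, e V k f, e' V k f]

theorem SameCoord.smul {U : Opens X} {w : FrameAssoc E hE U} {s : E.val.obj (op U)}
    (e : SameCoord hE w s) (a : A.obj.obj (op U)) : SameCoord hE (a • w) (a • s) := by
  intro V k f
  have r : frameAssocRes E hE k (a • w) = ringRes A k a • frameAssocRes E hE k w :=
    assoc_res_smul (frameSheaf E n hE) (𝟙 (GLSheaf A n)) k a w
  rw [r, frameCoord_smul, modRes_smul, e V k f]
  exact (map_smul (f.iso V le_rfl) _ _).symm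

theorem sameCoord_frameCls {U : Opens X} (f : Frame E n U) (a : Fin n → A.obj.obj (op U)) :
    SameCoord hE (frameCls E hE f a) (f.iso U le_rfl a) := by
  intro V k f'
  -- Any other frame over `V` is `f|_V · g`, and `g` cancels by `act_iso_frameCoord`.
  obtain ⟨g, rfl⟩ := (f.res k).act_bijective.2 f'
  rw [act_iso_frameCoord, frameCls_res, frameCoord_frameCls, Frame.res_iso]

/-- Sections of the sheaf associated with the sheaf of frames of `E` are sections of `E`. -/
noncomputable def frameAssocEquiv (U : Opens X) :
    FrameAssoc E hE U ≃ₗ[A.obj.obj (op U)] E.val.obj (op U) where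
  -- `SameCoord` is the graph of the isomorphism: it is functional in both directions and closed
  -- under the module operations, so all the laws follow from uniqueness.
  toFun w := (existsUnique_sameCoord hE w).choose
  invFun s := (existsUnique_sameCoord' hE s).choose
  left_inv w := ((existsUnique_sameCoord' hE _).choose_spec.2 w
    (existsUnique_sameCoord hE w).choose_spec.1).symm
  right_inv s := ((existsUnique_sameCoord hE _).choose_spec.2 s
    (existsUnique_sameCoord' hE s).choose_spec.1).symm
  map_add' w w' := ((existsUnique_sameCoord hE _).choose_spec.2 _
    ((existsUnique_sameCoord hE w).choose_spec.1.add hE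
      (existsUnique_sameCoord hE w').choose_spec.1)).symm
  map_smul' a w := ((existsUnique_sameCoord hE _).choose_spec.2 _
    ((existsUnique_sameCoord hE w).choose_spec.1.smul hE a)).symm

theorem frameAssocEquiv_eq {U : Opens X} {w : FrameAssoc E hE U} {s : E.val.obj (op U)}
    (e : SameCoord hE w s) : frameAssocEquiv hE U w = s :=
  ((existsUnique_sameCoord hE w).choose_spec.2 s e).symm

theorem frameAssocEquiv_res {V U : Opens X} (h : V ≤ U) (w : FrameAssoc E hE U) :
    frameAssocEquiv hE V (frameAssocRes E hE h w) = modRes E.val h (frameAssocEquiv hE U w) :=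
  frameAssocEquiv_eq hE ((existsUnique_sameCoord hE w).choose_spec.1.res hE h)

/-- The sheaf associated with the sheaf of frames of `E` by the identity representation is `E`. -/
noncomputable def frameAssocIso : assoc (frameSheaf E n hE) (𝟙 (GLSheaf A n)) ≅ E :=
  (SheafOfModules.fullyFaithfulForget (ringSheaf A)).preimageIso
    (PresheafOfModules.isoMk
      (fun U => LinearEquiv.toModuleIso (R := A.obj.obj (op U.unop))
        (X₁ := FrameAssoc E hE U.unop) (X₂ := E.val.obj (op U.unop)) (frameAssocEquiv hE U.unop))
      (by
        intro U V f
        ext w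
        exact frameAssocEquiv_res hE f.unop.le w))

theorem frameAssocIso_cls {U : Opens X} (f : Frame E n U) (a : Fin n → A.obj.obj (op U)) :
    (frameAssocIso hE).hom.val.app (op U) (cls (frameSheaf E n hE) (𝟙 (GLSheaf A n)) f a) =
      f.iso U le_rfl a :=
  frameAssocEquiv_eq hE (sameCoord_frameCls hE f a)

end AssociatedToFrames
-- Covariant derivatives in coordinates
section ConnectionCorrespondence

variable {𝕜 : Type} [RCLike 𝕜] {X : TopCat.{u}} (T : DifferentialTriad 𝕜 X)

namespace DifferentialTriad

theorem diff_add {U : Opens X} (a b : T.A.obj.obj (op U)) :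
    T.diff (a + b) = T.diff a + T.diff b :=
  map_add (T.d.d (X := op U)) a b

theorem diff_mul {U : Opens X} (a b : T.A.obj.obj (op U)) :
    T.diff (a * b) = a • T.diff b + b • T.diff a :=
  T.d.d_mul (X := op U) a b

theorem diff_zero (U : Opens X) : T.diff (0 : T.A.obj.obj (op U)) = 0 :=
  map_zero (T.d.d (X := op U))

theorem diff_one (U : Opens X) : T.diff (1 : T.A.obj.obj (op U)) = 0 :=
  PresheafOfModules.Derivation.d_one T.d (op U)

theorem diff_const (U : Opens X) (c : 𝕜) : T.diff (T.const U c) = 0 :=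
  PresheafOfModules.Derivation'.d_app T.d (X := op U) (ULift.up c)

theorem diff_sum {U : Opens X} {ι : Type*} (s : Finset ι) (a : ι → T.A.obj.obj (op U)) :
    T.diff (∑ i ∈ s, a i) = ∑ i ∈ s, T.diff (a i) :=
  map_sum (T.d.d (X := op U)) a s

theorem diff_res {V U : Opens X} (h : V ≤ U) (a : T.A.obj.obj (op U)) :
    T.diff (ringRes T.A h a) = modRes T.Ω.val h (T.diff a) :=
  T.d.d_map (homOfLE h).op a

end DifferentialTriad

variable {T} {n : ℕ} {E : SheafOfModules.{u} (ringSheaf T.A)}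

/-- The coefficients `∑ⱼ aⱼ θᵢⱼ + daᵢ` of the covariant derivative of `∑ⱼ aⱼ eⱼ`. -/
noncomputable def covDeriv {U : Opens X} (θ : Matrix (Fin n) (Fin n) (T.Ω.val.obj (op U)))
    (a : Fin n → T.A.obj.obj (op U)) : Fin n → T.Ω.val.obj (op U) :=
  fun i => ∑ j, a j • θ i j + T.diff (a i)

theorem covDeriv_add {U : Opens X} (θ : Matrix (Fin n) (Fin n) (T.Ω.val.obj (op U)))
    (a b : Fin n → T.A.obj.obj (op U)) :
    covDeriv θ (a + b) = covDeriv θ a + covDeriv θ b := by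
  funext i
  simp only [covDeriv, Pi.add_apply, T.diff_add, add_smul, Finset.sum_add_distrib]
  exact add_add_add_comm _ _ _ _

/-- The Leibniz condition in coordinates: the extra term `aᵢ dr` is the coordinate vector of `s ⊗
dr`. -/
theorem covDeriv_smul {U : Opens X} (θ : Matrix (Fin n) (Fin n) (T.Ω.val.obj (op U)))
    (r : T.A.obj.obj (op U)) (a : Fin n → T.A.obj.obj (op U)) :
    covDeriv θ (r • a) = r • covDeriv θ a + fun i => a i • T.diff r := by
  funext i
  simp only [covDeriv, Pi.add_apply, Pi.smul_apply, smul_eq_mul, T.diff_mul, mul_smul, smul_add,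
    Finset.smul_sum, add_assoc]

/-- Basis vectors have constant coordinates `0` and `1`, which `d` kills, so only the `j`-th column
of `θ` is left. -/
theorem covDeriv_single {U : Opens X} (θ : Matrix (Fin n) (Fin n) (T.Ω.val.obj (op U)))
    (j : Fin n) : covDeriv θ (Pi.single j 1) = fun i => θ i j := by
  funext i
  have e : T.diff ((Pi.single j 1 : Fin n → T.A.obj.obj (op U)) i) = 0 := by
    by_cases hij : i = j
    · subst hij
      rw [Pi.single_eq_same, T.diff_one]
    · rw [Pi.single_eq_of_ne hij, T.diff_zero]
  rw [covDeriv, e, add_zero, Finset.sum_eq_single j]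
  · rw [Pi.single_eq_same, one_smul]
  · intro k _ hk
    rw [Pi.single_eq_of_ne hk, zero_smul]
  · intro h
    exact absurd (Finset.mem_univ j) h

theorem covDeriv_res {V U : Opens X} (h : V ≤ U)
    (θ : Matrix (Fin n) (Fin n) (T.Ω.val.obj (op U))) (a : Fin n → T.A.obj.obj (op U)) :
    covDeriv (Matrix.of fun i j => modRes T.Ω.val h (θ i j)) (fun i => ringRes T.A h (a i)) =
      fun i => modRes T.Ω.val h (covDeriv θ a i) := by
  funext i
  simp only [covDeriv, T.diff_res, Matrix.of_apply, map_add]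
  refine congrArg (· + modRes T.Ω.val h (T.diff (a i))) ?_
  refine Eq.trans ?_ (map_sum (modRes T.Ω.val h) _ _).symm
  exact Finset.sum_congr rfl fun j _ => (modRes_smul T.Ω.val h (a j) (θ i j)).symm

/-- If `g θ' = θ g + dg`, then `θ (g a) + d(g a) = (θ g + dg) a + g da = g (θ' a + da)`. Thus the
local operators given by `θ` and `θ'` agree after the change of frame `g`. -/
theorem covDeriv_mulVec {U : Opens X} (g : Matrix (Fin n) (Fin n) (T.A.obj.obj (op U)))
    (θ θ' : Matrix (Fin n) (Fin n) (T.Ω.val.obj (op U)))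
    (H : ∀ i m, ∑ l, g i l • θ' l m = T.twist g θ i m) (a : Fin n → T.A.obj.obj (op U)) (i : Fin n) :
    covDeriv θ (g.mulVec a) i = ∑ l, g i l • covDeriv θ' a l := by
  have e1 : ∑ l, g i l • ∑ j, a j • θ' l j =
      ∑ j, a j • T.twist g θ i j := by
    simp only [← H, Finset.smul_sum]
    rw [Finset.sum_comm]
    simp only [smul_smul, mul_comm]
  have e2 : ∑ j, g.mulVec a j • θ i j = ∑ l, a l • ∑ j, g j l • θ i j := by
    simp only [Matrix.mulVec, dotProduct, Finset.smul_sum, Finset.sum_smul]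
    rw [Finset.sum_comm]
    simp only [smul_smul, mul_comm]
  have e3 : T.diff (g.mulVec a i) =
      ∑ l, g i l • T.diff (a l) + ∑ l, a l • T.diff (g i l) := by
    simp only [Matrix.mulVec, dotProduct, T.diff_sum, T.diff_mul, Finset.sum_add_distrib]
  simp only [covDeriv, smul_add, Finset.sum_add_distrib]
  rw [e1, e2, e3]
  simp only [DifferentialTriad.twist, Matrix.of_apply, smul_add, Finset.sum_add_distrib]
  abel

/-! ### From connections on `E` to connections on the sheaf of frames -/

namespace ModuleConnection

variable (D : ModuleConnection T E)

/-- The local connection form of `∇` with respect to a frame. -/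
noncomputable def form {U : Opens X} (f : Frame E n U) :
    Matrix (Fin n) (Fin n) (T.Ω.val.obj (op U)) :=
  Matrix.of fun i j => (frameTensor T.Ω f).symm (D.toFun U (f.basis j)) i

theorem apply_basis {U : Opens X} (f : Frame E n U) (j : Fin n) :
    D.toFun U (f.basis j) = frameTensor T.Ω f (fun i => D.form f i j) :=
  ((frameTensor T.Ω f).apply_symm_apply _).symm

/-- Additivity and the Leibniz condition on `∑ aⱼ eⱼ` show that the connection is determined, on
sections over `U`, by its matrix: it acts as `a ↦ θ a + da`. -/
theorem apply_iso {U : Opens X} (f : Frame E n U) (a : Fin n → T.A.obj.obj (op U)) :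
    D.toFun U (f.iso U le_rfl a) = frameTensor T.Ω f (covDeriv (D.form f) a) := by
  let F : E.val.obj (op U) →+ (tensorSheaf E.val T.Ω.val).val.obj (op U) :=
    AddMonoidHom.mk' (D.toFun U) (D.map_add U)
  have e1 : f.iso U le_rfl a = ∑ j, a j • f.basis j := by
    rw [Frame.iso_apply]
    exact Finset.sum_congr rfl fun j _ => congrArg (a j • ·) ((isSh_module E).res_self (f.basis j))
  have e2 : ∀ j, D.toFun U (a j • f.basis j) = frameTensor T.Ω f
      (a j • (fun i => D.form f i j) + Pi.single j (T.diff (a j))) := by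
    intro j
    rw [D.leibniz, D.apply_basis, _root_.map_add, map_smul]
    refine congrArg (a j • frameTensor T.Ω f (fun i => D.form f i j) + ·) ?_
    -- `eⱼ` is by definition the image of the `j`-th standard vector, so `eⱼ ⊗ daⱼ` has `daⱼ` in
    -- place `j` and zeros elsewhere.
    refine (tensorSec_iso T.Ω f (Pi.single j 1) (T.diff (a j))).trans ?_
    refine congrArg (frameTensor T.Ω f) (funext fun i => ?_)
    by_cases hij : i = j
    · subst hij
      rw [Pi.single_eq_same, Pi.single_eq_same, one_smul]
    · rw [Pi.single_eq_of_ne hij, Pi.single_eq_of_ne hij, zero_smul]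
  rw [e1]
  refine (map_sum F _ _).trans ((Finset.sum_congr rfl fun j _ => e2 j).trans ?_)
  rw [← map_sum, Finset.sum_add_distrib]
  refine congrArg (frameTensor T.Ω f) (funext fun i => ?_)
  rw [Pi.add_apply, Finset.sum_apply, Finset.sum_apply, Finset.sum_pi_single]
  simp only [Finset.mem_univ, if_true]
  rfl

theorem form_res {V U : Opens X} (h : V ≤ U) (f : Frame E n U) :
    D.form (f.res h) = Matrix.of fun i j => modRes T.Ω.val h (D.form f i j) := by
  refine Matrix.ext fun i j => congrFun (?_ : (fun i => D.form (f.res h) i j) =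
    fun i => modRes T.Ω.val h (D.form f i j)) i
  apply (frameTensor T.Ω (f.res h)).injective
  rw [← D.apply_basis, Frame.basis_res, D.map_res, D.apply_basis, frameTensor_res]

/-- The derivative of the `m`-th vector of `f · g` is computed in two ways: by the form of `f · g`,
and by `apply_iso` for `f` at the `m`-th column of `g`. -/
theorem form_act {U : Opens X} (f : Frame E n U)
    (g : Matrix.GeneralLinearGroup (Fin n) (T.A.obj.obj (op U))) (i m : Fin n) :
    ∑ l, g.val i l • D.form (f.act g) l m = T.twist g.val (D.form f) i m := by
  refine congrFun (?_ : (fun i => ∑ l, g.val i l • D.form (f.act g) l m) =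
    fun i => T.twist g.val (D.form f) i m) i
  apply (frameTensor T.Ω f).injective
  rw [← frameTensor_act, ← D.apply_basis, Frame.act_basis, D.apply_iso, Matrix.mulVec_single_one]
  rfl

/-- The connection on the sheaf of frames with the same local connection forms as `∇`. -/
noncomputable def toPrincipal (hE : IsVectorSheaf E n) :
    PrincipalConnection T (frameSheaf E n hE) where
  toFun U (f : Frame E n U) := T.ofMatrix (D.form f)
  map_res {V U} h (f : Frame E n U) := by
    refine Eq.trans ?_ (T.ofMatrix_res h (D.form f)).symm
    exact congrArg T.ofMatrix (D.form_res h f)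
  map_act U (f : Frame E n U) g :=
    (T.adAct_add_maurerCartan_eq_iff g (D.form f) (D.form (f.act g))).2 (D.form_act f g)

/-- The connection on `P(E)` determines the matrices `θ`, and these determine the connection on `E`
wherever a frame exists, hence everywhere. -/
theorem toPrincipal_injective (hE : IsVectorSheaf E n) :
    Function.Injective (fun D : ModuleConnection T E => D.toPrincipal hE) := by
  intro D D' e
  have hform : ∀ (U : Opens X) (f : Frame E n U), D.form f = D'.form f := fun U f =>
    T.ofMatrix_bijective.1 (congrArg (fun P => P.toFun U f) e)
  have hfun : D.toFun = D'.toFun := by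
    funext U s
    refine hE.eq_of_frames (isSh_module (tensorSheaf E.val T.Ω.val)) _ _ fun V k f => ?_
    rw [← D.map_res, ← D'.map_res]
    obtain ⟨a, ha⟩ := (f.iso V le_rfl).surjective (modRes E.val k s)
    rw [← ha, D.apply_iso, D'.apply_iso, hform]
  -- All fields other than `toFun` are propositions, so equality of the maps is enough.
  cases D
  cases D'
  cases hfun
  rfl

end ModuleConnection

/-! ### From connections on the sheaf of frames to connections on `E` -/

namespace PrincipalConnection

variable {hE : IsVectorSheaf E n} (D : PrincipalConnection T (frameSheaf E n hE))

/-- The local connection form of a connection on the sheaf of frames. -/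
noncomputable def form {U : Opens X} (f : Frame E n U) :
    Matrix (Fin n) (Fin n) (T.Ω.val.obj (op U)) :=
  (T.ofMatrix_bijective.2 (D.toFun U f)).choose

theorem ofMatrix_form {U : Opens X} (f : Frame E n U) : T.ofMatrix (D.form f) = D.toFun U f :=
  (T.ofMatrix_bijective.2 (D.toFun U f)).choose_spec

theorem form_res {V U : Opens X} (h : V ≤ U) (f : Frame E n U) :
    D.form (f.res h) = Matrix.of fun i j => modRes T.Ω.val h (D.form f i j) := by
  apply T.ofMatrix_bijective.1
  rw [← T.ofMatrix_res, D.ofMatrix_form, D.ofMatrix_form]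
  exact D.map_res h f

theorem form_act {U : Opens X} (f : Frame E n U)
    (g : Matrix.GeneralLinearGroup (Fin n) (T.A.obj.obj (op U))) (i m : Fin n) :
    ∑ l, g.val i l • D.form (f.act g) l m = T.twist g.val (D.form f) i m := by
  refine (T.adAct_add_maurerCartan_eq_iff g _ _).1 ?_ i m
  rw [D.ofMatrix_form, D.ofMatrix_form]
  exact D.map_act U f g

/-- The covariant derivative of the section with coordinates `a` with respect to `f`. -/
noncomputable def localConn {U : Opens X} (f : Frame E n U) (s : E.val.obj (op U)) :
    (tensorSheaf E.val T.Ω.val).val.obj (op U) :=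
  frameTensor T.Ω f (covDeriv (D.form f) ((f.iso U le_rfl).symm s))

theorem localConn_res {V U : Opens X} (h : V ≤ U) (f : Frame E n U) (s : E.val.obj (op U)) :
    D.localConn (f.res h) (modRes E.val h s) =
      modRes (tensorSheaf E.val T.Ω.val).val h (D.localConn f s) := by
  rw [localConn, localConn, frameTensor_res, Frame.res_iso_symm, D.form_res, covDeriv_res]

/-- The change of forms (`form_act`) and the change of coordinates (`frameTensor_act`) compensate
each other by `covDeriv_mulVec`; this is what allows gluing. -/
theorem localConn_act {U : Opens X} (f : Frame E n U)
    (g : Matrix.GeneralLinearGroup (Fin n) (T.A.obj.obj (op U))) (s : E.val.obj (op U)) :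
    D.localConn (f.act g) s = D.localConn f s := by
  obtain ⟨a, rfl⟩ := ((f.act g).iso U le_rfl).surjective s
  rw [localConn, localConn, LinearEquiv.symm_apply_apply, Frame.act_iso,
    LinearEquiv.symm_apply_apply, frameTensor_act]
  exact congrArg (frameTensor T.Ω f) (funext fun i =>
    (covDeriv_mulVec g.val (D.form f) (D.form (f.act g)) (D.form_act f g) a i).symm)

theorem localConn_add {U : Opens X} (f : Frame E n U) (s t : E.val.obj (op U)) :
    D.localConn f (s + t) = D.localConn f s + D.localConn f t := by
  rw [localConn, map_add, covDeriv_add, map_add]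
  rfl

theorem localConn_smul {U : Opens X} (f : Frame E n U) (a : T.A.obj.obj (op U))
    (s : E.val.obj (op U)) :
    D.localConn f (a • s) = a • D.localConn f s + tensorSec E.val T.Ω.val s (T.diff a) := by
  obtain ⟨b, rfl⟩ := (f.iso U le_rfl).surjective s
  rw [tensorSec_iso, localConn, localConn, ← map_smul, LinearEquiv.symm_apply_apply,
    LinearEquiv.symm_apply_apply, covDeriv_smul, map_add, map_smul]

theorem existsUnique_covariant {U : Opens X} (s : E.val.obj (op U)) :
    ∃! w : (tensorSheaf E.val T.Ω.val).val.obj (op U),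
      ∀ (V : Opens X) (k : V ≤ U) (f : Frame E n V),
        modRes (tensorSheaf E.val T.Ω.val).val k w = D.localConn f (modRes E.val k s) := by
  refine hE.existsUnique_glue (isSh_module (tensorSheaf E.val T.Ω.val))
    (fun V k f => D.localConn f (modRes E.val k s)) ?_ ?_
  · intro W V h k f
    rw [← (isSh_module E).res_res h k, localConn_res]
  · intro V k f g
    exact D.localConn_act f g _

/-- The covariant derivative of a section of `E`. -/
noncomputable def covariant {U : Opens X} (s : E.val.obj (op U)) :
    (tensorSheaf E.val T.Ω.val).val.obj (op U) :=
  (D.existsUnique_covariant s).choose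

theorem covariant_res {V U : Opens X} (k : V ≤ U) (f : Frame E n V) (s : E.val.obj (op U)) :
    modRes (tensorSheaf E.val T.Ω.val).val k (D.covariant s) =
      D.localConn f (modRes E.val k s) :=
  (D.existsUnique_covariant s).choose_spec.1 V k f

theorem eq_covariant {U : Opens X} {s : E.val.obj (op U)}
    {w : (tensorSheaf E.val T.Ω.val).val.obj (op U)}
    (H : ∀ (V : Opens X) (k : V ≤ U) (f : Frame E n V),
        modRes (tensorSheaf E.val T.Ω.val).val k w = D.localConn f (modRes E.val k s)) :
    D.covariant s = w :=
  ((D.existsUnique_covariant s).choose_spec.2 w H).symm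

/-- Both sides are sections of a sheaf, so the rule is checked in local frames, where it is
`covDeriv_smul`. -/
theorem covariant_smul {U : Opens X} (a : T.A.obj.obj (op U)) (s : E.val.obj (op U)) :
    D.covariant (a • s) = a • D.covariant s + tensorSec E.val T.Ω.val s (T.diff a) := by
  refine D.eq_covariant fun V k f => ?_
  rw [map_add, modRes_smul, modRes_smul, D.covariant_res k f, D.localConn_smul, tensorSec_res,
    T.diff_res]

/-- The connection on `E` with the same local connection forms as `D`. -/
noncomputable def toModule : ModuleConnection T E where
  toFun U s := D.covariant s
  map_res {V U} h s := by
    refine D.eq_covariant fun W k f => ?_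
    rw [(isSh_module _).res_res, (isSh_module E).res_res, D.covariant_res _ f]
  map_add U s t := by
    refine D.eq_covariant fun V k f => ?_
    rw [map_add, map_add, D.covariant_res k f, D.covariant_res k f, D.localConn_add]
  map_scalar U c s := by
    -- Constants have `dc = 0`, so `𝕜`-linearity is the Leibniz condition with the vanishing term `s
    -- ⊗ 0`.
    have e : tensorSec E.val T.Ω.val s 0 = 0 := by
      have := tensorSec_add_right E.val T.Ω.val s 0 0
      rwa [add_zero, left_eq_add] at this
    rw [D.covariant_smul, T.diff_const, e, add_zero]
  leibniz U a s := D.covariant_smul a s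

/-- On the vectors of a frame the glued operator is given by that frame's own local formula, whose
value at the `j`-th standard vector is the `j`-th column of the form. -/
theorem toModule_form {U : Opens X} (f : Frame E n U) : D.toModule.form f = D.form f := by
  refine Matrix.ext fun i j => congrFun (?_ : (fun i => D.toModule.form f i j) =
    fun i => D.form f i j) i
  apply (frameTensor T.Ω f).injective
  rw [← ModuleConnection.apply_basis, ← covDeriv_single]
  have e := D.covariant_res le_rfl f (f.basis j)
  rw [(isSh_module _).res_self, (isSh_module E).res_self, localConn, Frame.basis,
    LinearEquiv.symm_apply_apply] at e
  exact e

theorem toModule_toPrincipal : D.toModule.toPrincipal hE = D := by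
  have hfun : (D.toModule.toPrincipal hE).toFun = D.toFun := by
    funext U (f : Frame E n U)
    exact (congrArg T.ofMatrix (D.toModule_form f)).trans (D.ofMatrix_form f)
  -- The left side becomes a variable, so that both structures can be destructed and compared by
  -- `toFun` alone.
  generalize D.toModule.toPrincipal hE = D' at hfun
  cases D
  cases D'
  cases hfun
  rfl

end PrincipalConnection

/-- The correspondence between connections on `E` and connections on its sheaf of frames. -/
noncomputable def connectionEquiv (hE : IsVectorSheaf E n) :
    ModuleConnection T E ≃ PrincipalConnection T (frameSheaf E n hE) :=
  Equiv.ofBijective (fun D => D.toPrincipal hE)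
    ⟨ModuleConnection.toPrincipal_injective hE, fun D => ⟨D.toModule, D.toModule_toPrincipal⟩⟩

end ConnectionCorrespondence

end ADG

theorem corollary2 {𝕜 : Type} [RCLike 𝕜] {X : TopCat.{u}} (T : ADG.DifferentialTriad 𝕜 X) (n : ℕ)
    (E : SheafOfModules.{u} (ADG.ringSheaf T.A)) (hE : ADG.IsVectorSheaf E n) :
    (∃ F : ADG.assoc (ADG.frameSheaf E n hE) (𝟙 (ADG.GLSheaf T.A n)) ≅ E,
      ∀ (U : Opens X) (f : ADG.Frame E n U) (a : Fin n → T.A.obj.obj (op U)),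
        F.hom.val.app (op U)
          (ADG.cls (ADG.frameSheaf E n hE) (𝟙 (ADG.GLSheaf T.A n)) f a) = f.iso U le_rfl a) ∧
    ∃ Θ : ADG.ModuleConnection T E ≃ ADG.PrincipalConnection T (ADG.frameSheaf E n hE),
      ∀ (D : ADG.ModuleConnection T E) (U : Opens X) (f : ADG.Frame E n U),
        ∃ θ : Matrix (Fin n) (Fin n) (T.Ω.val.obj (op U)),
          (∀ j, D.toFun U (f.basis j) =
            ∑ i, ADG.tensorSec E.val T.Ω.val (f.basis i) (θ i j)) ∧
          (Θ D).toFun U f = T.ofMatrix θ :=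
  ⟨⟨ADG.frameAssocIso hE, fun _ f a => ADG.frameAssocIso_cls hE f a⟩,
    -- The required matrix is the form of `D` in the frame `f`; the value of the corresponding
    -- connection on `P(E)` at `f` is this matrix by definition.
    ADG.connectionEquiv hE, fun D _ f => ⟨D.form f, D.apply_basis f, rfl⟩⟩
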